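/- **Setting.** Let $R$ be a complete discrete valuation ring with uniformizer $\pi$, valuation $\mathrm{val}$ and fraction field $K$. Let $w$ be a monomial order on $A=K[X_1,\dots,X_n]$ that refines the total degree, $LM$ and $LC$ the leading monomial and leading coefficient for $w$, and $D\in\mathbb N$. An approximate polynomial is an expression $P=p+\sum_u O(\pi^{m_u})X^u$ with $p\in A$ and $m_u\in\mathbb N\cup\{\infty\}$, where $O(\pi^m)=\pi^mR$ and $O(\pi^\infty)=0$; its specializations are the polynomials $p+\sum_u b_uX^u$ with $b_u\in\pi^{m_u}R$. Let $f_1,\dots,f_s\in A$, $d_i=\deg f_i$, and let $f_i^h$ be the homogeneous component of $f_i$ of degree $d_i$. An approximation of $(f_1,\dots,f_s)$ with precision $m$ is a sequence $(f_1',\dots,f_s')$ of approximate polynomials such that $f_i$ is a specialization of $f_i'$, the coefficients of $f'_i$ in degrees $\le d_i$ have precision at least $m$, and $f_i'$ has only exact zero coefficients in degrees $>d_i$. *$D$-Gröbner bases.* A $D$-Gröbner basis of an ideal $I\subseteq A$ is a finite sequence in $I$ such that the leading monomial of every nonzero $p\in I$ with $\deg p\le D$ is divisible by the leading monomial of one of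 its nonzero members. A $D$-Gröbner basis of a system $F=(F_1,\dots,F_s)$ with $\deg F_i\le d_i$ is a finite sequence in $\langle F_1,\dots,F_s\rangle$ such that the same divisibility holds for every nonzero $p=\sum_i h_iF_i$ with $\deg h_i+d_i\le D$ whenever $h_i\ne0$ (the row space of the affine Macaulay matrix of degree $D$). An *approximate* $D$-Gröbner basis of $(f'_1,\dots,f_s')$, of the ideal or of the system, is a finite sequence $G=(G_1,\dots,G_r)$ of approximate polynomials such that: all coefficients of $G_k$ on monomials larger than the leading monomial of its center are exact zeros, and all specializations of $G_k$ are nonzero with the same leading monomial; and for every specialization $F$ of $f'$ there is a specialization of $G$ that is a $D$-Gröbner basis of $\langle F_1,\dots,F_s\rangle$, respectively of the system $F$. *Hypotheses.* **H1** for $(h_1,\dots,h_s)$: it is a regular sequence in $A$. **H2**: for $1\le i\le s$ the ideal $I=\langle h_1,\dots,h_i\rangle$ is weakly-$w$, i.e. whenever $x^\alpha$ is a leading monomial of an element of the reduced Gröbner basis of $I$, every $x^\beta>_wx^\alpha$ with $|\beta|=|\alpha|$ is in $LM(I)$. *Precisions.* For homogeneous $h_1,\dots,h_s\in R[X_1,\dots,X_n]$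 let $\mathrm{Mac}_{d,i}$ be the matrix whose rows are the polynomials $x^\alpha h_j$ with $j\le i$ and $|\alpha|+\deg h_j=d$, written in the monomials of degree $d$ in decreasing order, and let $\overline{\mathrm{Mac}}_{d,i}$ be its submatrix of the rows with $x^\alpha\notin LM(\langle h_1,\dots,h_{j-1}\rangle_A)$. Let $l_{d,i}$ be the largest $l$ such that the first $l$ columns of $\overline{\mathrm{Mac}}_{d,i}$ are linearly independent. Let $prec_{MF5}(h,D,w)$, resp. $prec_{Mac}(h,D,w)$, be the maximum over $d\le D$ and $1\le i\le s$ (zero if $s=0$) of the minimal valuation of an $l_{d,i}$-minor on the first $l_{d,i}$ columns of $\overline{\mathrm{Mac}}_{d,i}$, resp. of $\mathrm{Mac}_{d,i}$. **Proposition 7.1.** Assume that $(f_1^h,\dots,f_s^h)$ satisfies **H1** and **H2**. 1. There is an $M$ such that for every $m\ge M$, every approximation of $(f_1,\dots,f_s)$ with precision $m$ has an approximate $D$-Gröbner basis of the ideal. 2. Suppose that $f_1,\dots,f_s\in R[X_1,\dots,X_n]$, and let $c$ be either $prec_{MF5}((f_1^h,\dots,f_s^h),D,w)$ or $prec_{Mac}((f_1^h,\dots,f_s^h),D,w)$.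 Then for every $m>c$, every approximation $(f_1',\dots,f_s')$ with precision $m$ has an approximate $D$-Gröbner basis $G$ of the system such that: - for every specialization $F$, the specialization of $G$ can be chosen so that it is moreover a $D$-Gröbner basis of the ideal $\langle F_1,\dots,F_s\rangle$ if the degree-$d_i$ components of the $F_i$ form a regular sequence (in particular for $F=f$); - if the reduced Gröbner bases of the ideals $\langle f_1^h,\dots,f_i^h\rangle$, $1\le i\le s$, have no element of degree $>D$, then $G$ is an approximate $D$-Gröbner basis of the ideal; - the loss in precision is at most $c$: for every $k$, the leading coefficient $LC(G_k)$ of the center of $G_k$ is in $R$, and every coefficient of $G_k$ has absolute precision at least $m-c+\mathrm{val}(LC(G_k))\ \ (\ge m-c)$. -/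

import Mathlib

open MvPolynomial

noncomputable section

namespace ApproxGroebner

/-! ### Leading monomials, Gröbner bases, weakly-`w` ideals -/

section Groebner

variable {n s : ℕ} {K : Type*} [Field K]

/-- The monomial order `w` refines the total degree. -/
def RefinesTotalDegree (w : MonomialOrder (Fin n)) : Prop :=
  ∀ a b : Fin n →₀ ℕ, a.degree < b.degree → w.toSyn a < w.toSyn b

/-- Exponents of the leading monomials of the nonzero elements of `I`. -/
def leadingMonomials (w : MonomialOrder (Fin n)) (I : Ideal (MvPolynomial (Fin n) K)) :
    Set (Fin n →₀ ℕ) :=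
  {u | ∃ p ∈ I, p ≠ 0 ∧ w.degree p = u}

/-- `G` is the reduced Gröbner basis of `I` with respect to `w`. -/
structure IsReducedGroebnerBasis (w : MonomialOrder (Fin n)) (I : Ideal (MvPolynomial (Fin n) K))
    (G : Set (MvPolynomial (Fin n) K)) : Prop where
  finite : G.Finite
  subset : ∀ g ∈ G, g ∈ I
  monic : ∀ g ∈ G, w.leadingCoeff g = 1
  cover : ∀ p ∈ I, p ≠ 0 → ∃ g ∈ G, w.degree g ≤ w.degree p
  reduced : ∀ g ∈ G, ∀ g' ∈ G, g' ≠ g → ∀ u ∈ g.support, ¬ w.degree g' ≤ u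

/-- `I` is a weakly-`w` ideal: every monomial of the same degree as, and larger than, a leading
monomial of the reduced Gröbner basis of `I` is a leading monomial of `I`. -/
def IsWeaklyIdeal (w : MonomialOrder (Fin n)) (I : Ideal (MvPolynomial (Fin n) K)) : Prop :=
  ∃ G, IsReducedGroebnerBasis w I G ∧ ∀ g ∈ G, ∀ b : Fin n →₀ ℕ,
    b.degree = (w.degree g).degree → w.toSyn (w.degree g) < w.toSyn b → b ∈ leadingMonomials w I

/-- The ideal generated by the first `k` polynomials of the sequence `h`. -/
def prefixIdeal (h : Fin s → MvPolynomial (Fin n) K) (k : ℕ) :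
    Ideal (MvPolynomial (Fin n) K) :=
  Ideal.span (h '' {j | (j : ℕ) < k})

/-- The hypothesis **H1**: regular sequence. -/
def H1 (h : Fin s → MvPolynomial (Fin n) K) : Prop :=
  RingTheory.Sequence.IsRegular (MvPolynomial (Fin n) K) (List.ofFn h)

/-- The hypothesis **H2**: all the ideals `⟨h₁, …, hᵢ⟩`, `1 ≤ i ≤ s`, are weakly-`w`. -/
def H2 (w : MonomialOrder (Fin n)) (h : Fin s → MvPolynomial (Fin n) K) : Prop :=
  ∀ i : Fin s, IsWeaklyIdeal w (prefixIdeal h (i + 1))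

/-- `(g₁, …, g_r)` is a `D`-Gröbner basis of the ideal `I`: it lies in `I`, and the leading
monomial of every nonzero element of `I` of degree at most `D` is divisible by some `LM(g_k)`. -/
def IsDGroebnerBasis (w : MonomialOrder (Fin n)) (D : ℕ) (I : Ideal (MvPolynomial (Fin n) K))
    {r : ℕ} (g : Fin r → MvPolynomial (Fin n) K) : Prop :=
  (∀ k, g k ∈ I) ∧
    ∀ p ∈ I, p ≠ 0 → p.totalDegree ≤ D → ∃ k, g k ≠ 0 ∧ w.degree (g k) ≤ w.degree p

/-- `(g₁, …, g_r)` is a `D`-Gröbner basis of the affine system `(F₁, …, F_s)`, where `F_i` is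
seen as a polynomial of degree `d_i`: it lies in `⟨F₁, …, F_s⟩`, and the leading monomial of every
nonzero `p = ∑ hᵢ Fᵢ` with `deg hᵢ + dᵢ ≤ D` whenever `hᵢ ≠ 0` (that is, of every nonzero
polynomial in the row space of the degree `D` affine Macaulay matrix) is divisible by some
`LM(g_k)`. -/
def IsSystemDGroebnerBasis (w : MonomialOrder (Fin n)) (D : ℕ) (d : Fin s → ℕ)
    (F : Fin s → MvPolynomial (Fin n) K) {r : ℕ} (g : Fin r → MvPolynomial (Fin n) K) : Prop :=
  (∀ k, g k ∈ Ideal.span (Set.range F)) ∧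
    ∀ h : Fin s → MvPolynomial (Fin n) K, (∀ i, h i ≠ 0 → (h i).totalDegree + d i ≤ D) →
      ∑ i, h i * F i ≠ 0 → ∃ k, g k ≠ 0 ∧ w.degree (g k) ≤ w.degree (∑ i, h i * F i)

end Groebner

/-- The homogeneous components of highest degree of the `f_i`. -/
def topComponents {n s : ℕ} {A : Type*} [CommRing A] (f : Fin s → MvPolynomial (Fin n) A) :
    Fin s → MvPolynomial (Fin n) A :=
  fun i => homogeneousComponent (f i).totalDegree (f i)

/-! ### Approximate polynomials and approximate bases

`R` is a complete discrete valuation ring and `K` its field of fractions. -/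

section Approx

variable (R : Type*) [CommRing R] [IsDomain R] [IsDiscreteValuationRing R]
  {K : Type*} [Field K] [Algebra R K] {n s : ℕ}

/-- `x` belongs to `O(π^m) = π^m R`, where `O(π^∞) = {0}`. -/
def InBall (m : ℕ∞) (x : K) : Prop :=
  ∃ a : R, algebraMap R K a = x ∧ m ≤ IsDiscreteValuationRing.addVal R a

/-- An approximate polynomial `g + ∑ᵤ O(π^{mᵤ}) X^u`, with `mᵤ ∈ ℕ ∪ {∞}`. -/
structure ApproxPoly (n : ℕ) (K : Type*) [Field K] where
  center : MvPolynomial (Fin n) K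
  prec : (Fin n →₀ ℕ) → ℕ∞

/-- `F` is a specialization of the approximate polynomial `P`. -/
def ApproxPoly.Contains (P : ApproxPoly n K) (F : MvPolynomial (Fin n) K) : Prop :=
  ∀ u, InBall R (P.prec u) (F.coeff u - P.center.coeff u)

/-- The `f'_i` are approximations of the `f_i`, whose coefficients on the monomials of degree at
most `deg f_i` are known at precision (at least) `m`, while `f'_i` has no term, exact or
approximate, of degree larger than `deg f_i`. -/
def IsApproximation (m : ℕ) (f : Fin s → MvPolynomial (Fin n) K)
    (f' : Fin s → ApproxPoly n K) : Prop :=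
  ∀ i, (f' i).Contains R (f i) ∧
    ∀ u : Fin n →₀ ℕ, (u.degree ≤ (f i).totalDegree → (m : ℕ∞) ≤ (f' i).prec u) ∧
      ((f i).totalDegree < u.degree → (f' i).prec u = ⊤)

/-- The leading monomial of `P` does not depend on the specialization: the coefficients of the
monomials larger than `LM` of the center are exact zeros, and all the specializations of `P` are
nonzero with the same leading monomial. -/
def ApproxPoly.HasFixedLeadingMonomial (w : MonomialOrder (Fin n)) (P : ApproxPoly n K) : Prop :=
  (∀ u, w.toSyn (w.degree P.center) < w.toSyn u → P.prec u = ⊤) ∧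
    ∀ g, P.Contains R g → g ≠ 0 ∧ w.degree g = w.degree P.center

/-- The sequence `G` of approximate polynomials is an approximate basis, in the sense specified by
the property `IsBasis F g` ("`g` is a basis for the system `F`"), of the approximate system `f'`:
its leading monomials are fixed, and every specialization `F` of `f'` has a basis `g` that is a
specialization of `G`. -/
def IsApproximateBasis (w : MonomialOrder (Fin n)) {r : ℕ}
    (IsBasis : (Fin s → MvPolynomial (Fin n) K) → (Fin r → MvPolynomial (Fin n) K) → Prop)
    (f' : Fin s → ApproxPoly n K) (G : Fin r → ApproxPoly n K) : Prop :=
  (∀ k, (G k).HasFixedLeadingMonomial R w) ∧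
    ∀ F : Fin s → MvPolynomial (Fin n) K, (∀ i, (f' i).Contains R (F i)) →
      ∃ g : Fin r → MvPolynomial (Fin n) K, (∀ k, (G k).Contains R (g k)) ∧ IsBasis F g

/-- For input precision `m`, the loss of precision in `G` is at most `c`: for all `k` and `u`,
`m - prec(G_k, u) ≤ c - val(LC(G_k))`, where `LC(G_k) ∈ R`, so that `prec(G_k, u) ≥ m - c`.
The term `val(LC(G_k))` makes the condition invariant under the rescaling of `G_k` by a power
of `π`, by which otherwise the absolute precision could be increased at will. -/
def LossAtMost (w : MonomialOrder (Fin n)) (m : ℕ) (c : ℕ∞) {r : ℕ}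
    (G : Fin r → ApproxPoly n K) : Prop :=
  ∀ k, ∃ a : R, algebraMap R K a = w.leadingCoeff (G k).center ∧
    ∀ u, (m : ℕ∞) + IsDiscreteValuationRing.addVal R a ≤ (G k).prec u + c

end Approx

/-! ### Macaulay matrices and the precisions `prec_MF5` and `prec_Mac` -/

section Macaulay

/-- The set of exponents of degree `d`. -/
def monomialsOfDegree (n d : ℕ) : Finset (Fin n →₀ ℕ) :=
  (Finset.univ : Finset (Fin n)).finsuppAntidiag d

/-- The monomials of degree `d`, enumerated in decreasing order for `w`. -/
def column {n : ℕ} (w : MonomialOrder (Fin n)) (d : ℕ) (j : Fin (monomialsOfDegree n d).card) :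
    Fin n →₀ ℕ :=
  w.toSyn.symm (((monomialsOfDegree n d).map w.toSyn.toEquiv.toEmbedding).orderEmbOfFin
    (Finset.card_map _) j.rev)

variable {R : Type*} [CommRing R] {n s : ℕ}

/-- Labels `(j, α)` of the rows `X^α h_j` of `Mac_d(h₁, …, hᵢ)`. -/
def macaulayRows (h : Fin s → MvPolynomial (Fin n) R) (d : ℕ) (i : Fin s) :
    Set (Fin s × (Fin n →₀ ℕ)) :=
  {p | p.1 ≤ i ∧ p.2.degree + (h p.1).totalDegree = d}

/-- The rows that are kept by the F5 criterion: those `X^α h_j` such that `X^α` is not a leading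
monomial of `⟨h₁, …, h_{j-1}⟩ ⊆ K[X₁, …, X_n]`. -/
def f5Rows (K : Type*) [Field K] [Algebra R K] (w : MonomialOrder (Fin n))
    (h : Fin s → MvPolynomial (Fin n) R) (d : ℕ) (i : Fin s) : Set (Fin s × (Fin n →₀ ℕ)) :=
  {p | p ∈ macaulayRows h d i ∧
    p.2 ∉ leadingMonomials w (prefixIdeal (fun j => map (algebraMap R K) (h j)) p.1)}

/-- The matrix of the polynomials `X^α h_j`, `(j, α) ∈ S`, in the basis of the monomials of
degree `d` in decreasing order: `Mac_d(h₁, …, hᵢ)` for `S = macaulayRows h d i`, and its F5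
version for `S = f5Rows K w h d i`. -/
def macaulayMatrix (w : MonomialOrder (Fin n)) (h : Fin s → MvPolynomial (Fin n) R) (d : ℕ)
    (S : Set (Fin s × (Fin n →₀ ℕ))) : Matrix S (Fin (monomialsOfDegree n d).card) R :=
  Matrix.of fun p j => (monomial p.1.2 1 * h p.1.1).coeff (column w d j)

/-- The largest `l` such that the first `l` columns of `M` are linearly independent. (Over a
domain, this is the same as linear independence over the field of fractions.) -/
def freeColumns {ι : Type*} {N : ℕ} (M : Matrix ι (Fin N) R) : ℕ :=
  sSup {l | l ≤ N ∧ LinearIndependent R (fun (j : {j : Fin N // (j : ℕ) < l}) (a : ι) => M a j)}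

/-- The smallest valuation of an `l`-minor of `M` on its first `l` columns. -/
def minMinorVal [IsDomain R] [IsDiscreteValuationRing R] {ι : Type*} {N : ℕ}
    (M : Matrix ι (Fin N) R) (l : ℕ) : ℕ∞ :=
  ⨅ (e : Fin l → ι) (c : Fin l → Fin N) (_ : ∀ k, (c k : ℕ) = k),
    IsDiscreteValuationRing.addVal R (M.submatrix e c).det

/-- The number `l_{d,i}` of first columns of the F5-Macaulay matrix that are free. -/
def freeCount (K : Type*) [Field K] [Algebra R K] (w : MonomialOrder (Fin n))
    (h : Fin s → MvPolynomial (Fin n) R) (d : ℕ) (i : Fin s) : ℕ :=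
  freeColumns (macaulayMatrix w h d (f5Rows K w h d i))

/-- The Matrix-F5 precision `prec_MF5({h₁, …, h_s}, D, w)`. -/
def precMF5 [IsDomain R] [IsDiscreteValuationRing R] (K : Type*) [Field K] [Algebra R K]
    (w : MonomialOrder (Fin n)) (D : ℕ) (h : Fin s → MvPolynomial (Fin n) R) : ℕ∞ :=
  ⨆ (d : ℕ) (_ : d ≤ D) (i : Fin s),
    minMinorVal (macaulayMatrix w h d (f5Rows K w h d i)) (freeCount K w h d i)

/-- The Macaulay precision `prec_Mac({h₁, …, h_s}, D, w)`. -/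
def precMac [IsDomain R] [IsDiscreteValuationRing R] (K : Type*) [Field K] [Algebra R K]
    (w : MonomialOrder (Fin n)) (D : ℕ) (h : Fin s → MvPolynomial (Fin n) R) : ℕ∞ :=
  ⨆ (d : ℕ) (_ : d ≤ D) (i : Fin s),
    minMinorVal (macaulayMatrix w h d (macaulayRows h d i)) (freeCount K w h d i)

end Macaulay

end ApproxGroebner

end

/-! Write `h` for the top components of `f` and `B i` for the reduced Gröbner bases of their prefix
ideals. The row space of an affine Macaulay matrix of a specialization `F` is `macSpan d F k e`: the
span of the multiples `X^α F_j`, `j < k`, with `|α| + d_j ≤ e`. It suffices to attain in these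
spaces the leading monomials of the `B i`, by polynomials that depend on `F` in a controlled way,
and then to show that no other leading monomials occur.

Attaining: by **H2**, every monomial of degree `e` above a leading monomial of `B i` of degree `e`
is a leading monomial of the prefix ideal. Hence all the columns up to it are free in the F5 matrix
(`lt_freeCount`), and some minor on the first columns is nonzero. Multiplying the corresponding rows
of the affine matrix of `F` by the adjugate of this minor gives polynomials whose leading monomials
are the first columns and whose leading coefficient is the minor (`cramerPoly`,
`degree_map_cramerPoly`). The minor involves only top components. Being polynomial expressions in
the coefficients, the minor and the new polynomials move by elements of valuation at least `m` when
the system does (`le_addVal_cramerPoly_sub`). If the minor has valuation less than `m`, its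
valuation is therefore constant and the leading monomials are fixed. The absolute precision stays
`m`, while the leading coefficient has valuation at most the bound `δ`; this is the bound on the
loss (`exists_attainsReducedBases`).

No others: the top components of `F` need not be a regular sequence, so the argument counts
dimensions. Once the leading monomials of the prefix ideals of `h` are attained by `F`, the F5
criterion shows that the rows labelled by `f5Labels` span the row space of `F`
(`macSpan_le_span_f5Labels`). For `h`, which is regular, the rows with the same labels are
independent, so there are at most as many labels as leading monomials of `h` (`ncard_f5Labels_le`).
An additional leading monomial for `F` would exceed this dimension
(`degree_mem_leadingMonomials_of_mem_macSpan`).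

This settles the system. For the ideal, either the `B i` have degree at most `D` and the argument
applies in every degree, or the top components of `F` are regular and falls of degree are excluded
(`mem_macSpan_of_homogeneousComponent_eq_zero`). The qualitative statement clears denominators and
uses a degree bound that contains all the `B i`. -/

noncomputable section

namespace ApproxGroebner

/-! ### Affine Macaulay row spaces and falls of degree. -/

section FilteredSpan

variable {n s : ℕ} {K : Type*} [Field K]

/-- A polynomial with a nonzero coefficient at `u` and none above it has leading exponent `u`. -/
theorem monomialOrder_degree_eq {A : Type*} [CommRing A] (w : MonomialOrder (Fin n))
    {p : MvPolynomial (Fin n) A}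
    {u : Fin n →₀ ℕ} (hu : p.coeff u ≠ 0)
    (h : ∀ v, w.toSyn u < w.toSyn v → p.coeff v = 0) : w.degree p = u := by
  apply w.toSyn.injective
  apply le_antisymm
  · by_contra hlt
    have hp : p ≠ 0 := by rintro rfl; simp at hu
    exact (w.coeff_degree_ne_zero_iff.mpr hp) (h _ (not_le.mp hlt))
  · exact w.le_degree (mem_support_iff.mpr hu)

/-- The span of the multiples `X^α F_j`, `j < k`, with `|α| + d_j ≤ e`: the row space of an affine
Macaulay matrix. -/
def macSpan (d : Fin s → ℕ) (F : Fin s → MvPolynomial (Fin n) K) (k e : ℕ) :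
    Submodule K (MvPolynomial (Fin n) K) :=
  Submodule.span K {p | ∃ (j : Fin s) (α : Fin n →₀ ℕ), (j : ℕ) < k ∧ α.degree + d j ≤ e ∧
    p = monomial α 1 * F j}

variable {d : Fin s → ℕ} {F : Fin s → MvPolynomial (Fin n) K} {k e : ℕ}

theorem monomial_mul_mem_macSpan {j : Fin s} {α : Fin n →₀ ℕ} (hj : (j : ℕ) < k)
    (hα : α.degree + d j ≤ e) : monomial α 1 * F j ∈ macSpan d F k e :=
  Submodule.subset_span ⟨j, α, hj, hα, rfl⟩

theorem macSpan_mono {k' e' : ℕ} (hk : k ≤ k') (he : e ≤ e') :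
    macSpan d F k e ≤ macSpan d F k' e' := by
  apply Submodule.span_mono
  rintro p ⟨j, α, hj, hα, rfl⟩
  exact ⟨j, α, hj.trans_le hk, hα.trans he, rfl⟩

theorem monomial_mul_mem_macSpan_of_mem {p : MvPolynomial (Fin n) K} (hp : p ∈ macSpan d F k e)
    (β : Fin n →₀ ℕ) : monomial β 1 * p ∈ macSpan d F k (e + β.degree) := by
  induction hp using Submodule.span_induction with
  | mem p hp =>
    obtain ⟨j, α, hj, hα, rfl⟩ := hp
    rw [← mul_assoc, monomial_mul, one_mul]
    apply monomial_mul_mem_macSpan hj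
    rw [map_add]; omega
  | zero => simp
  | add p q _ _ hp hq => rw [mul_add]; exact add_mem hp hq
  | smul c p _ hp => rw [mul_smul_comm]; exact Submodule.smul_mem _ _ hp

theorem mul_mem_of_monomial_mul_mem {V : Submodule K (MvPolynomial (Fin n) K)}
    {a p : MvPolynomial (Fin n) K} (h : ∀ u ∈ a.support, monomial u 1 * p ∈ V) : a * p ∈ V := by
  rw [a.as_sum, Finset.sum_mul]
  refine sum_mem fun u hu => ?_
  have : monomial u (a.coeff u) * p = a.coeff u • (monomial u 1 * p) := by
    rw [← smul_mul_assoc, smul_monomial, smul_eq_mul, mul_one]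
  rw [this]
  exact V.smul_mem _ (h u hu)

theorem mul_mem_macSpan {j : Fin s} (hj : (j : ℕ) < k) {a : MvPolynomial (Fin n) K}
    (ha : ∀ u ∈ a.support, u.degree + d j ≤ e) : a * F j ∈ macSpan d F k e :=
  mul_mem_of_monomial_mul_mem fun u hu => monomial_mul_mem_macSpan hj (ha u hu)

theorem mul_mem_macSpan_of_mem {p : MvPolynomial (Fin n) K} (hp : p ∈ macSpan d F k e)
    {a : MvPolynomial (Fin n) K} {t : ℕ} (ha : ∀ u ∈ a.support, u.degree ≤ t) :
    a * p ∈ macSpan d F k (e + t) :=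
  mul_mem_of_monomial_mul_mem fun u hu => macSpan_mono le_rfl
    (Nat.add_le_add_left (ha u hu) e) (monomial_mul_mem_macSpan_of_mem hp u)

theorem mem_prefixIdeal_of_mem_macSpan {p : MvPolynomial (Fin n) K} (hp : p ∈ macSpan d F k e) :
    p ∈ prefixIdeal F k := by
  have : macSpan d F k e ≤ (prefixIdeal F k).restrictScalars K := by
    refine Submodule.span_le.mpr ?_
    rintro p ⟨j, α, hj, -, rfl⟩
    exact Ideal.mul_mem_left _ _ (Ideal.subset_span ⟨j, hj, rfl⟩)
  exact this hp

/-- The bound `e` may have to exceed the degree of `p`; controlling this gap is what separates bases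
of the system from bases of the ideal. -/
theorem exists_mem_macSpan (d : Fin s → ℕ) {p : MvPolynomial (Fin n) K}
    (hp : p ∈ prefixIdeal F k) : ∃ e, p ∈ macSpan d F k e := by
  induction hp using Submodule.span_induction with
  | mem p hp =>
    obtain ⟨j, hj, rfl⟩ := hp
    refine ⟨d j, ?_⟩
    have := monomial_mul_mem_macSpan (d := d) (F := F) (k := k) (j := j) (α := 0) (e := d j) hj
      (by simp)
    simpa using this
  | zero => exact ⟨0, zero_mem _⟩
  | add p q _ _ hp hq =>
    obtain ⟨e, he⟩ := hp
    obtain ⟨e', he'⟩ := hq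
    exact ⟨max e e', add_mem (macSpan_mono le_rfl (le_max_left _ _) he)
      (macSpan_mono le_rfl (le_max_right _ _) he')⟩
  | smul a p _ hp =>
    obtain ⟨e, he⟩ := hp
    refine ⟨e + a.totalDegree, mul_mem_macSpan_of_mem he fun u hu => ?_⟩
    rw [Finsupp.degree_eq_sum]
    simpa [Finsupp.sum_fintype] using le_totalDegree hu

theorem exists_mem_macSpan_succ {i : Fin s} {p : MvPolynomial (Fin n) K}
    (hp : p ∈ macSpan d F (i + 1) e) :
    ∃ v ∈ macSpan d F i e, ∃ a : MvPolynomial (Fin n) K,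
      (∀ u ∈ a.support, u.degree + d i ≤ e) ∧ p = v + a * F i := by
  classical
  induction hp using Submodule.span_induction with
  | mem p hp =>
    obtain ⟨j, α, hj, hα, rfl⟩ := hp
    rcases Nat.lt_succ_iff_lt_or_eq.mp hj with h | h
    · exact ⟨_, monomial_mul_mem_macSpan h hα, 0, by simp, by simp⟩
    · obtain rfl : j = i := Fin.ext h
      refine ⟨0, zero_mem _, monomial α 1, fun u hu => ?_, by simp⟩
      rw [Finset.mem_singleton.mp (support_monomial_subset hu)]
      exact hα
  | zero => exact ⟨0, zero_mem _, 0, by simp, by simp⟩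
  | add p q _ _ hp hq =>
    obtain ⟨v, hv, a, ha, rfl⟩ := hp
    obtain ⟨v', hv', a', ha', rfl⟩ := hq
    refine ⟨v + v', add_mem hv hv', a + a', fun u hu => ?_, by ring⟩
    exact (Finset.mem_union.mp (support_add hu)).elim (ha u) (ha' u)
  | smul c p _ hp =>
    obtain ⟨v, hv, a, ha, rfl⟩ := hp
    refine ⟨c • v, Submodule.smul_mem _ _ hv, c • a, fun u hu => ha u (support_smul hu), ?_⟩
    rw [smul_add, smul_mul_assoc]

theorem coeff_eq_zero_of_mem_macSpan (hF : ∀ j u, d j < u.degree → (F j).coeff u = 0)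
    {p : MvPolynomial (Fin n) K} (hp : p ∈ macSpan d F k e) {u : Fin n →₀ ℕ}
    (hu : e < u.degree) : p.coeff u = 0 := by
  induction hp using Submodule.span_induction with
  | mem p hp =>
    obtain ⟨j, α, hj, hα, rfl⟩ := hp
    rw [coeff_monomial_mul']
    split_ifs with h
    · rw [hF, mul_zero]
      obtain ⟨v, rfl⟩ := exists_add_of_le h
      rw [add_tsub_cancel_left]
      rw [map_add] at hu
      omega
    · rfl
  | zero => simp
  | add p q _ _ hp hq => rw [coeff_add, hp, hq, add_zero]
  | smul c p _ hp => rw [coeff_smul, hp, smul_zero]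

theorem homogeneousComponent_monomial_mul (α : Fin n →₀ ℕ) (p : MvPolynomial (Fin n) K) (t : ℕ) :
    homogeneousComponent (α.degree + t) (monomial α 1 * p) =
      monomial α 1 * homogeneousComponent t p := by
  ext u
  simp only [coeff_homogeneousComponent, coeff_monomial_mul']
  by_cases h : α ≤ u
  · obtain ⟨v, rfl⟩ := exists_add_of_le h
    simp [map_add]
  · simp [h]

/-- Here `t` and `r` are only upper bounds for the degrees, so either factor on the right may
vanish. This matters because a specialization may have degree less than `d_j`. -/
theorem homogeneousComponent_mul_homogeneousComponent {a p : MvPolynomial (Fin n) K} {t : ℕ}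
    (ha : ∀ u ∈ a.support, u.degree ≤ t) {r : ℕ} (hp : ∀ u, r < u.degree → p.coeff u = 0) :
    homogeneousComponent (t + r) (a * p) =
      homogeneousComponent t a * homogeneousComponent r p := by
  have key : ∀ u, u.degree ≤ t → ∀ c : K, homogeneousComponent (t + r) (monomial u c * p) =
      homogeneousComponent t (monomial u c) * homogeneousComponent r p := by
    intro u hu c
    have hc : (monomial u c : MvPolynomial (Fin n) K) = c • monomial u 1 := by
      rw [smul_monomial, smul_eq_mul, mul_one]
    rw [hc, smul_mul_assoc, map_smul, map_smul, smul_mul_assoc]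
    congr 1
    have e1 : t + r = u.degree + (t - u.degree + r) := by omega
    rw [e1, homogeneousComponent_monomial_mul]
    rcases hu.eq_or_lt with h | h
    · subst h
      rw [homogeneousComponent_of_mem (n := u.degree) (isHomogeneous_monomial 1 rfl), if_pos rfl]
      simp
    · rw [homogeneousComponent_of_mem (n := u.degree) (isHomogeneous_monomial 1 rfl),
        if_neg h.ne', zero_mul]
      have : homogeneousComponent (t - u.degree + r) p = 0 := by
        ext v
        rw [coeff_homogeneousComponent, coeff_zero]
        split_ifs with hv
        · exact hp v (by omega)
        · rfl
      rw [this, mul_zero]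
  conv_lhs => rw [a.as_sum]
  conv_rhs => rw [a.as_sum]
  rw [Finset.sum_mul, map_sum, map_sum, Finset.sum_mul]
  exact Finset.sum_congr rfl fun u hu => key u (ha u hu) _

/-- Homogeneous components of degree `e` of the ideal of the top components are top components of
elements of the affine row space. -/
theorem exists_homogeneousComponent_eq_of_mem_prefixIdeal {p : MvPolynomial (Fin n) K}
    (hp : p ∈ prefixIdeal (fun j => homogeneousComponent (d j) (F j)) k) (e : ℕ) :
    ∃ v ∈ macSpan d F k e, homogeneousComponent e v = homogeneousComponent e p := by
  obtain ⟨E, hE⟩ := exists_mem_macSpan d hp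
  clear hp
  induction hE using Submodule.span_induction with
  | mem p hp =>
    obtain ⟨j, α, hj, -, rfl⟩ := hp
    have hhom : (monomial α 1 * homogeneousComponent (d j) (F j)).IsHomogeneous
        (α.degree + d j) :=
      (isHomogeneous_monomial 1 rfl).mul (homogeneousComponent_isHomogeneous _ _)
    by_cases h : e = α.degree + d j
    · subst h
      refine ⟨_, monomial_mul_mem_macSpan hj le_rfl, ?_⟩
      rw [homogeneousComponent_of_mem hhom, if_pos rfl, homogeneousComponent_monomial_mul]
    · refine ⟨0, zero_mem _, ?_⟩
      rw [homogeneousComponent_of_mem hhom, if_neg h, map_zero]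
  | zero => exact ⟨0, zero_mem _, rfl⟩
  | add p q _ _ hp hq =>
    obtain ⟨v, hv, h⟩ := hp
    obtain ⟨v', hv', h'⟩ := hq
    exact ⟨v + v', add_mem hv hv', by rw [map_add, map_add, h, h']⟩
  | smul c p _ hp =>
    obtain ⟨v, hv, h⟩ := hp
    exact ⟨c • v, Submodule.smul_mem _ _ hv, by rw [map_smul, map_smul, h]⟩

theorem homogeneousComponent_mem_prefixIdeal (hF : ∀ j u, d j < u.degree → (F j).coeff u = 0)
    {v : MvPolynomial (Fin n) K} (hv : v ∈ macSpan d F k e) :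
    homogeneousComponent e v ∈ prefixIdeal (fun j => homogeneousComponent (d j) (F j)) k := by
  induction hv using Submodule.span_induction with
  | mem p hp =>
    obtain ⟨j, α, hj, hα, rfl⟩ := hp
    obtain ⟨t, rfl⟩ := exists_add_of_le hα
    rw [add_assoc, homogeneousComponent_monomial_mul]
    rcases Nat.eq_zero_or_pos t with rfl | ht
    · exact Ideal.mul_mem_left _ _ (Ideal.subset_span ⟨j, hj, rfl⟩)
    · have : homogeneousComponent (d j + t) (F j) = 0 := by
        ext v
        rw [coeff_homogeneousComponent, coeff_zero]
        split_ifs with hv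
        · exact hF j v (by omega)
        · rfl
      rw [this, mul_zero]
      exact zero_mem _
  | zero => simp
  | add p q _ _ hp hq => rw [map_add]; exact add_mem hp hq
  | smul c p _ hp => rw [map_smul]; exact Submodule.smul_of_tower_mem _ c hp

/-- If the top components form a regular sequence, there is no unexpected fall of degree. -/
theorem mem_macSpan_of_homogeneousComponent_eq_zero
    (hF : ∀ j u, d j < u.degree → (F j).coeff u = 0)
    (hreg : ∀ (i : Fin s) (a : MvPolynomial (Fin n) K),
      a * homogeneousComponent (d i) (F i) ∈
        prefixIdeal (fun j => homogeneousComponent (d j) (F j)) i →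
      a ∈ prefixIdeal (fun j => homogeneousComponent (d j) (F j)) i) :
    ∀ k ≤ s, ∀ {e : ℕ} {p : MvPolynomial (Fin n) K}, p ∈ macSpan d F k (e + 1) →
      homogeneousComponent (e + 1) p = 0 → p ∈ macSpan d F k e := by
  intro k
  induction k with
  | zero =>
    intro _ e p hp _
    have : p ∈ prefixIdeal F 0 := mem_prefixIdeal_of_mem_macSpan hp
    simp only [prefixIdeal, not_lt_zero, Set.ofPred_false, Set.image_empty, Ideal.span_empty,
      Ideal.mem_bot] at this
    rw [this]
    exact zero_mem _
  | succ k ih =>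
    intro hk e p hp h0
    set i : Fin s := ⟨k, hk⟩ with hi
    obtain ⟨v, hv, a, ha, rfl⟩ := exists_mem_macSpan_succ (i := i) hp
    change v ∈ macSpan d F k (e + 1) at hv
    by_cases hd : d i ≤ e + 1
    swap
    · have : a = 0 := by
        by_contra hne
        obtain ⟨u, hu⟩ := (support_nonempty.mpr hne)
        have := ha u hu
        omega
      subst this
      rw [zero_mul, add_zero] at h0 ⊢
      exact macSpan_mono (Nat.le_succ k) le_rfl (ih (by omega) hv h0)
    obtain ⟨t, ht⟩ := exists_add_of_le hd
    have hat : ∀ u ∈ a.support, u.degree ≤ t := fun u hu => by have := ha u hu; omega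
    have het : e + 1 = t + d i := by omega
    have htop : homogeneousComponent (e + 1) (a * F i) =
        homogeneousComponent t a * homogeneousComponent (d i) (F i) := by
      rw [het]
      exact homogeneousComponent_mul_homogeneousComponent hat (hF i)
    -- The vanishing of the top component of `v + a F_i` is a syzygy of the top components, to which
    -- regularity applies.
    have hmem : homogeneousComponent t a ∈
        prefixIdeal (fun j => homogeneousComponent (d j) (F j)) k := by
      apply hreg i
      rw [← htop]
      have h1 : homogeneousComponent (e + 1) (a * F i) = - homogeneousComponent (e + 1) v := by
        rw [map_add] at h0
        exact eq_neg_of_add_eq_zero_right h0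
      rw [h1]
      exact neg_mem (homogeneousComponent_mem_prefixIdeal hF hv)
    -- Lift the top part of `a` to an affine combination `v'` of the earlier polynomials: `a - v'`
    -- then has smaller degree.
    obtain ⟨v', hv', hv't⟩ := exists_homogeneousComponent_eq_of_mem_prefixIdeal hmem t
    have hv'a : homogeneousComponent t (a - v') = 0 := by
      rw [map_sub, hv't, homogeneousComponent_of_mem (homogeneousComponent_isHomogeneous t a),
        if_pos rfl, sub_self]
    have ha' : ∀ u ∈ (a - v').support, u.degree + d i ≤ e := by
      intro u hu
      have hcoeff := mem_support_iff.mp hu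
      have h1 : ¬ t < u.degree := by
        intro hlt
        apply hcoeff
        rw [coeff_sub, coeff_eq_zero_of_mem_macSpan hF hv' hlt, sub_zero]
        by_contra hne
        exact absurd (hat u (mem_support_iff.mpr hne)) (by omega)
      have h2 : u.degree ≠ t := by
        intro h
        apply hcoeff
        have := congrArg (coeff u) hv'a
        rwa [coeff_homogeneousComponent, if_pos h, coeff_zero] at this
      omega
    have hrest : (a - v') * F i ∈ macSpan d F (k + 1) e :=
      mul_mem_macSpan (Nat.lt_succ_self k) ha'
    -- With the roles exchanged, `v' F_i` is a multiple of `v'`, hence a combination of the earlier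
    -- polynomials, and the induction hypothesis applies.
    have hw : v + v' * F i ∈ macSpan d F k (e + 1) := by
      refine add_mem hv ?_
      rw [mul_comm, het]
      exact mul_mem_macSpan_of_mem hv' fun u hu => by
        by_contra hlt
        exact mem_support_iff.mp hu (hF i u (not_le.mp hlt))
    have hw0 : homogeneousComponent (e + 1) (v + v' * F i) = 0 := by
      have h1 : homogeneousComponent (e + 1) ((a - v') * F i) = 0 := by
        ext u
        rw [coeff_homogeneousComponent, coeff_zero]
        split_ifs with hu
        · exact coeff_eq_zero_of_mem_macSpan hF hrest (by omega)
        · rfl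
      have h2 : v + v' * F i = (v + a * F i) - (a - v') * F i := by ring
      rw [h2, map_sub, h0, h1, sub_zero]
    have h3 : v + a * F i = (v + v' * F i) + (a - v') * F i := by ring
    rw [h3]
    exact add_mem (macSpan_mono (Nat.le_succ k) le_rfl (ih (by omega) hw hw0)) hrest

end FilteredSpan

/-! ### The F5 criterion and the count of leading monomials. -/

section Counting

variable {n s : ℕ} {K : Type*} [Field K]

/-- Polynomials with distinct leading monomials are linearly independent. -/
theorem linearIndependent_of_injective_degree (w : MonomialOrder (Fin n)) {ι : Type*}
    {v : ι → MvPolynomial (Fin n) K} (hv : ∀ i, v i ≠ 0)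
    (hinj : Function.Injective fun i => w.degree (v i)) : LinearIndependent K v := by
  rw [linearIndependent_iff]
  intro l hl
  by_contra hne
  obtain ⟨i, hi, hmax⟩ := l.support.exists_max_image (fun i => w.toSyn (w.degree (v i)))
    (Finsupp.support_nonempty_iff.mpr hne)
  have h := congrArg (coeff (w.degree (v i))) hl
  rw [Finsupp.linearCombination_apply, Finsupp.sum, coeff_sum,
    Finset.sum_eq_single_of_mem i hi, coeff_smul, coeff_zero, smul_eq_mul] at h
  · exact (mul_ne_zero (Finsupp.mem_support_iff.mp hi)
      (w.coeff_degree_ne_zero_iff.mpr (hv i))) h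
  · intro j hj hji
    rw [coeff_smul, w.coeff_eq_zero_of_lt, smul_zero]
    exact lt_of_le_of_ne (hmax j hj) fun h => hji (hinj (w.toSyn.injective h))

/-- Labels of the rows of the affine Macaulay matrix that are kept by the F5 criterion. -/
def f5Labels (w : MonomialOrder (Fin n)) (d : Fin s → ℕ) (h : Fin s → MvPolynomial (Fin n) K)
    (k e : ℕ) : Set (Fin s × (Fin n →₀ ℕ)) :=
  {p | (p.1 : ℕ) < k ∧ p.2.degree + d p.1 ≤ e ∧ p.2 ∉ leadingMonomials w (prefixIdeal h p.1)}

/-- Up to degree `E`, the leading monomials of the ideals `⟨h₁, …, h_k⟩` are attained in the affine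
Macaulay row spaces of `F`. -/
def CoversLeadingMonomials (w : MonomialOrder (Fin n)) (d : Fin s → ℕ)
    (h F : Fin s → MvPolynomial (Fin n) K) (E : ℕ) : Prop :=
  ∀ k ≤ s, ∀ u ∈ leadingMonomials w (prefixIdeal h k), u.degree ≤ E →
    ∃ g ∈ macSpan d F k u.degree, g ≠ 0 ∧ w.degree g = u

variable {w : MonomialOrder (Fin n)} {d : Fin s → ℕ} {h F : Fin s → MvPolynomial (Fin n) K}

theorem finite_f5Labels (w : MonomialOrder (Fin n)) (d : Fin s → ℕ)
    (h : Fin s → MvPolynomial (Fin n) K) (k e : ℕ) : (f5Labels w d h k e).Finite :=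
  (Set.finite_univ.prod (Finsupp.finite_of_degree_le e)).subset fun _ hp =>
    ⟨Set.mem_univ _, (Nat.le_add_right _ _).trans hp.2.1⟩

/-- The F5 criterion: the rows with labels in `f5Labels` span the affine Macaulay row space. -/
theorem macSpan_le_span_f5Labels (hw : RefinesTotalDegree w)
    (hF : ∀ j u, d j < u.degree → (F j).coeff u = 0) {E : ℕ}
    (cov : CoversLeadingMonomials w d h F E) : ∀ k ≤ s, ∀ e ≤ E,
      macSpan d F k e ≤ Submodule.span K
        ((fun p : Fin s × (Fin n →₀ ℕ) => monomial p.2 1 * F p.1) '' f5Labels w d h k e) := by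
  intro k
  induction k with
  | zero =>
    intro _ e _
    refine Submodule.span_le.mpr ?_
    rintro p ⟨j, α, hj, -⟩
    exact absurd hj (Nat.not_lt_zero _)
  | succ k ih =>
    intro hk e he
    set W := Submodule.span K
      ((fun p : Fin s × (Fin n →₀ ℕ) => monomial p.2 1 * F p.1) '' f5Labels w d h (k + 1) e)
      with hW
    have hprev : macSpan d F k e ≤ W := (ih (by omega) e he).trans <|
      Submodule.span_mono <| Set.image_mono fun _ hp => ⟨hp.1.trans (Nat.lt_succ_self k), hp.2⟩
    refine Submodule.span_le.mpr ?_
    rintro p ⟨j, α, hj, hα, rfl⟩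
    rcases Nat.lt_succ_iff_lt_or_eq.mp hj with hjk | hjk
    · exact hprev (monomial_mul_mem_macSpan hjk hα)
    induction hx : w.toSyn α using WellFoundedLT.induction generalizing α with
    | _ x ihx =>
      by_cases hmem : α ∈ leadingMonomials w (prefixIdeal h j)
      swap
      · exact Submodule.subset_span ⟨(j, α), ⟨hj, hα, hmem⟩, rfl⟩
      obtain ⟨g, hg, hg0, hgα⟩ := cov j (by omega) α hmem (by omega)
      have hc : g.coeff α ≠ 0 := hgα ▸ w.coeff_degree_ne_zero_iff.mpr hg0
      -- `g` is a combination of polynomials before `F_j`, so `g F_j` is handled by the induction on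
      -- `k`.
      have h1 : g * F j ∈ W := by
        apply hprev
        rw [mul_comm, ← hjk]
        refine macSpan_mono le_rfl hα (mul_mem_macSpan_of_mem hg fun u hu => ?_)
        by_contra hlt
        exact mem_support_iff.mp hu (hF j u (not_le.mp hlt))
      -- The tail of `g` has smaller monomials, of no larger degree since `w` refines the degree:
      -- inner induction on `α`.
      have h2 : (g - monomial α (g.coeff α)) * F j ∈ W := by
        refine mul_mem_of_monomial_mul_mem fun u hu => ?_
        have hcu := mem_support_iff.mp hu
        rw [coeff_sub, coeff_monomial] at hcu
        have hne : α ≠ u := by rintro rfl; simp at hcu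
        rw [if_neg hne, sub_zero] at hcu
        have hlt : w.toSyn u < w.toSyn α := by
          refine lt_of_le_of_ne (hgα ▸ w.le_degree (mem_support_iff.mpr hcu)) fun h => hne ?_
          exact (w.toSyn.injective h).symm
        have hdeg : u.degree ≤ α.degree := by
          by_contra hlt'
          exact lt_asymm hlt (hw _ _ (not_le.mp hlt'))
        exact ihx _ (hx ▸ hlt) u (by omega) rfl
      have h3 : monomial α 1 * F j =
          (g.coeff α)⁻¹ • (g * F j - (g - monomial α (g.coeff α)) * F j) := by
        have : g * F j - (g - monomial α (g.coeff α)) * F j = monomial α (g.coeff α) * F j := by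
          ring
        rw [this, ← smul_mul_assoc, smul_monomial, smul_eq_mul, inv_mul_cancel₀ hc]
      rw [h3]
      exact W.smul_mem _ (W.sub_mem h1 h2)

/-- For a regular sequence, the rows kept by the F5 criterion are linearly independent. -/
theorem linearIndependent_f5
    (hreg : ∀ (i : Fin s) (a : MvPolynomial (Fin n) K),
      a * h i ∈ prefixIdeal h i → a ∈ prefixIdeal h i) :
    LinearIndependent K
      (fun p : {p : Fin s × (Fin n →₀ ℕ) // p.2 ∉ leadingMonomials w (prefixIdeal h p.1)} =>
        monomial p.1.2 (1 : K) * h p.1.1) := by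
  classical
  rw [linearIndependent_iff]
  intro l hl
  by_contra hne
  -- Let `i` be the largest index in the relation and `a` the cofactor of `h_i`. Regularity puts `a`
  -- in the previous ideal, whereas all its monomials are labels outside the leading monomials of
  -- that ideal.
  obtain ⟨q, hq, hmax⟩ := l.support.exists_max_image (fun p => p.1.1)
    (Finsupp.support_nonempty_iff.mpr hne)
  set i := q.1.1 with hi
  set a : MvPolynomial (Fin n) K :=
    ∑ p ∈ l.support with p.1.1 = i, monomial p.1.2 (l p) with ha
  have hcoeff : ∀ u, a.coeff u =
      ∑ p ∈ l.support with p.1.1 = i, if p.1.2 = u then l p else 0 := by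
    intro u
    rw [ha, coeff_sum]
    exact Finset.sum_congr rfl fun p _ => coeff_monomial _ _ _
  have hmem : a ∈ prefixIdeal h i := by
    apply hreg
    rw [Finsupp.linearCombination_apply, Finsupp.sum,
      ← Finset.sum_filter_add_sum_filter_not _ (fun p => p.1.1 = i)] at hl
    have h1 : a * h i =
        ∑ p ∈ l.support with p.1.1 = i, l p • (monomial p.1.2 (1 : K) * h p.1.1) := by
      rw [ha, Finset.sum_mul]
      refine Finset.sum_congr rfl fun p hp => ?_
      rw [← smul_mul_assoc, smul_monomial, smul_eq_mul, mul_one, (Finset.mem_filter.mp hp).2]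
    rw [h1, eq_neg_of_add_eq_zero_left hl]
    refine neg_mem (sum_mem fun p hp => ?_)
    obtain ⟨hp, hpi⟩ := Finset.mem_filter.mp hp
    refine Submodule.smul_of_tower_mem _ _ (Ideal.mul_mem_left _ _ (Ideal.subset_span ⟨_, ?_, rfl⟩))
    exact lt_of_le_of_ne (hmax p hp) hpi
  have ha0 : a ≠ 0 := by
    intro h0
    have := hcoeff q.1.2
    have hq' : q ∈ l.support.filter fun p => p.1.1 = i := Finset.mem_filter.mpr ⟨hq, rfl⟩
    rw [h0, coeff_zero, Finset.sum_eq_single_of_mem q hq', if_pos rfl] at this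
    · exact Finsupp.mem_support_iff.mp hq this.symm
    · intro p hp hpq
      refine if_neg fun h2 => hpq (Subtype.ext (Prod.ext ?_ h2))
      exact (Finset.mem_filter.mp hp).2
  have hdeg := w.coeff_degree_ne_zero_iff.mpr ha0
  rw [hcoeff] at hdeg
  obtain ⟨p, hp, hp0⟩ := Finset.exists_ne_zero_of_sum_ne_zero hdeg
  have hpd : p.1.2 = w.degree a := by
    by_contra hne
    exact hp0 (if_neg hne)
  apply p.2
  rw [hpd, (Finset.mem_filter.mp hp).2]
  exact ⟨a, hmem, ha0, rfl⟩

/-- The leading monomials of degree at most `e`. -/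
def leadingMonomialsLE (w : MonomialOrder (Fin n)) (I : Ideal (MvPolynomial (Fin n) K)) (e : ℕ) :
    Set (Fin n →₀ ℕ) :=
  {u ∈ leadingMonomials w I | u.degree ≤ e}

theorem finite_leadingMonomialsLE (w : MonomialOrder (Fin n))
    (I : Ideal (MvPolynomial (Fin n) K)) (e : ℕ) : (leadingMonomialsLE w I e).Finite :=
  (Finsupp.finite_of_degree_le e).subset fun _ hu => hu.2

/-- Reading only the coefficients at the leading exponents is injective on the row space, since a
nonzero element has a nonzero coefficient at its own leading exponent. The independent F5 rows thus
embed in a space of the right dimension. -/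
theorem ncard_f5Labels_le (hh : ∀ j u, d j < u.degree → (h j).coeff u = 0)
    (hreg : ∀ (i : Fin s) (a : MvPolynomial (Fin n) K),
      a * h i ∈ prefixIdeal h i → a ∈ prefixIdeal h i) (k e : ℕ) :
    (f5Labels w d h k e).ncard ≤ (leadingMonomialsLE w (prefixIdeal h k) e).ncard := by
  have := (finite_f5Labels w d h k e).fintype
  have := (finite_leadingMonomialsLE w (prefixIdeal h k) e).fintype
  let T : MvPolynomial (Fin n) K →ₗ[K] (leadingMonomialsLE w (prefixIdeal h k) e → K) :=
    LinearMap.pi fun u => lcoeff K u.1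
  have hind : LinearIndependent K (fun p : f5Labels w d h k e =>
      monomial p.1.2 (1 : K) * h p.1.1) :=
    (linearIndependent_f5 (w := w) hreg).comp
      (fun p : f5Labels w d h k e => (⟨p.1, p.2.2.2⟩ :
        {p : Fin s × (Fin n →₀ ℕ) // p.2 ∉ leadingMonomials w (prefixIdeal h p.1)}))
      fun p q hpq => Subtype.ext (congrArg (fun x => x.1) hpq)
  have hT := hind.map (f := T) (by
    rw [Submodule.disjoint_def]
    intro p hp hker
    have hp' : p ∈ macSpan d h k e := by
      refine Submodule.span_le.mpr ?_ hp
      rintro _ ⟨q, rfl⟩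
      exact monomial_mul_mem_macSpan q.2.1 q.2.2.1
    by_contra hne
    have hc := w.coeff_degree_ne_zero_iff.mpr hne
    have hle : (w.degree p).degree ≤ e := by
      by_contra hlt
      exact hc (coeff_eq_zero_of_mem_macSpan hh hp' (not_le.mp hlt))
    exact hc (congrFun (LinearMap.mem_ker.mp hker)
      ⟨w.degree p, ⟨p, mem_prefixIdeal_of_mem_macSpan hp', hne, rfl⟩, hle⟩))
  have := hT.fintype_card_le_finrank
  rwa [Module.finrank_fintype_fun_eq_card, ← Nat.card_eq_fintype_card,
    ← Nat.card_eq_fintype_card] at this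

/-- If the leading monomials of the regular sequence `h` are attained by `F`, the affine Macaulay
row spaces of `F` have no other leading monomials. -/
theorem degree_mem_leadingMonomials_of_mem_macSpan (hw : RefinesTotalDegree w)
    (hF : ∀ j u, d j < u.degree → (F j).coeff u = 0)
    (hh : ∀ j u, d j < u.degree → (h j).coeff u = 0)
    (hreg : ∀ (i : Fin s) (a : MvPolynomial (Fin n) K),
      a * h i ∈ prefixIdeal h i → a ∈ prefixIdeal h i)
    {E : ℕ} (cov : CoversLeadingMonomials w d h F E) {k : ℕ} (hk : k ≤ s)
    {p : MvPolynomial (Fin n) K} (hp : p ∈ macSpan d F k E) (hp0 : p ≠ 0) :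
    w.degree p ∈ leadingMonomials w (prefixIdeal h k) := by
  classical
  by_contra hnot
  have hfL := (finite_f5Labels w d h k E)
  have := (finite_leadingMonomialsLE w (prefixIdeal h k) E).fintype
  have hch : ∀ u : leadingMonomialsLE w (prefixIdeal h k) E,
      ∃ g ∈ macSpan d F k E, g ≠ 0 ∧ w.degree g = u.1 := fun u => by
    obtain ⟨g, hg, h1⟩ := cov k hk u.1 u.2.1 u.2.2
    exact ⟨g, macSpan_mono le_rfl u.2.2 hg, h1⟩
  choose g hg hg0 hgu using hch
  -- One polynomial for each leading monomial of `h`, and `p` as an extra one: if the leading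
  -- monomial of `p` were new, this family would be independent and larger than the spanning set of
  -- F5 rows.
  let v : Option (leadingMonomialsLE w (prefixIdeal h k) E) → MvPolynomial (Fin n) K :=
    fun o => o.elim p g
  have hv : LinearIndependent K v := by
    refine linearIndependent_of_injective_degree w ?_ ?_
    · rintro (_ | u)
      exacts [hp0, hg0 u]
    · rintro (_ | u) (_ | u') hu
      · rfl
      · refine absurd ?_ hnot
        have hu : w.degree p = w.degree (g u') := hu
        rw [hu, hgu]
        exact u'.2.1
      · refine absurd ?_ hnot
        have hu : w.degree (g u) = w.degree p := hu
        rw [← hu, hgu]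
        exact u.2.1
      · have hu : w.degree (g u) = w.degree (g u') := hu
        rw [hgu, hgu] at hu
        rw [Subtype.ext hu]
  have := (hfL.image fun p : Fin s × (Fin n →₀ ℕ) => monomial p.2 (1 : K) * F p.1).fintype
  have hcard := linearIndependent_le_span' v hv
    ((fun p : Fin s × (Fin n →₀ ℕ) => monomial p.2 1 * F p.1) '' f5Labels w d h k E) (by
      rintro _ ⟨o, rfl⟩
      refine macSpan_le_span_f5Labels hw hF cov k hk E le_rfl ?_
      rcases o with _ | u
      exacts [hp, hg u])
  rw [Cardinal.mk_fintype, Fintype.card_option, Nat.cast_le,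
    ← Nat.card_eq_fintype_card (α := _ '' _), Nat.card_coe_set_eq] at hcard
  have h1 := hcard.trans (Set.ncard_image_le hfL)
  have h2 := ncard_f5Labels_le (w := w) hh hreg k E
  rw [← Nat.card_coe_set_eq, ← Nat.card_coe_set_eq (leadingMonomialsLE _ _ _),
    Nat.card_eq_fintype_card (α := leadingMonomialsLE _ _ _), Nat.card_coe_set_eq] at h2
  omega

/-- Leading monomials of an ideal generated by homogeneous polynomials are attained in the
corresponding degree. -/
theorem coversLeadingMonomials_topComponents
    (hF : ∀ j u, d j < u.degree → (F j).coeff u = 0) (hw : RefinesTotalDegree w) (E : ℕ) :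
    CoversLeadingMonomials w d (fun j => homogeneousComponent (d j) (F j)) F E := by
  rintro k - u ⟨p, hp, hp0, rfl⟩ -
  obtain ⟨v, hv, hvp⟩ := exists_homogeneousComponent_eq_of_mem_prefixIdeal hp (w.degree p).degree
  have key : ∀ u : Fin n →₀ ℕ, u.degree = (w.degree p).degree → v.coeff u = p.coeff u := by
    intro u hu
    have := congrArg (coeff u) hvp
    rwa [coeff_homogeneousComponent, coeff_homogeneousComponent, if_pos hu, if_pos hu] at this
  have hc : v.coeff (w.degree p) ≠ 0 := by
    rw [key _ rfl]
    exact w.coeff_degree_ne_zero_iff.mpr hp0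
  refine ⟨v, hv, fun h => hc (by rw [h, coeff_zero]), monomialOrder_degree_eq w hc ?_⟩
  intro u hu
  rcases lt_trichotomy u.degree (w.degree p).degree with h | h | h
  · exact absurd (hw _ _ h) (lt_asymm hu)
  · rw [key u h]
    exact w.coeff_eq_zero_of_lt hu
  · exact coeff_eq_zero_of_mem_macSpan hF hv h

end Counting

theorem map_monomial_one_mul {A B : Type*} [CommRing A] [CommRing B] {n : ℕ} (φ : A →+* B)
    (u : Fin n →₀ ℕ) (p : MvPolynomial (Fin n) A) :
    map φ (monomial u 1 * p) = monomial u 1 * map φ p := by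
  rw [map_mul, map_monomial, φ.map_one]

/-! ### Columns of the Macaulay matrices and free columns. -/

section Columns

variable {n : ℕ} {w : MonomialOrder (Fin n)} {d : ℕ}

theorem mem_monomialsOfDegree {u : Fin n →₀ ℕ} : u ∈ monomialsOfDegree n d ↔ u.degree = d := by
  simp [monomialsOfDegree, Finset.mem_finsuppAntidiag, Finsupp.degree_eq_sum]

theorem column_lt {j j' : Fin (monomialsOfDegree n d).card} :
    w.toSyn (column w d j) < w.toSyn (column w d j') ↔ j' < j := by
  simp [column]

theorem degree_column (j : Fin (monomialsOfDegree n d).card) : (column w d j).degree = d := by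
  rw [← mem_monomialsOfDegree]
  have := Finset.orderEmbOfFin_mem
    ((monomialsOfDegree n d).map w.toSyn.toEquiv.toEmbedding) (Finset.card_map _) j.rev
  obtain ⟨u, hu, h⟩ := Finset.mem_map.mp this
  rw [column, ← h]
  simpa using hu

theorem exists_column_eq {u : Fin n →₀ ℕ} (hu : u.degree = d) : ∃ j, column w d j = u := by
  have hmem : w.toSyn u ∈ (monomialsOfDegree n d).map w.toSyn.toEquiv.toEmbedding :=
    Finset.mem_map.mpr ⟨u, mem_monomialsOfDegree.mpr hu, rfl⟩
  have := Finset.range_orderEmbOfFin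
    ((monomialsOfDegree n d).map w.toSyn.toEquiv.toEmbedding) (Finset.card_map _)
  rw [← Finset.mem_coe, ← this] at hmem
  obtain ⟨j, hj⟩ := hmem
  exact ⟨j.rev, by rw [column, Fin.rev_rev, hj, AddEquiv.symm_apply_apply]⟩

end Columns

section FreeColumns

variable {R : Type*} [CommRing R] {ι : Type*} {N : ℕ}

theorem bddAbove_freeColumns (M : Matrix ι (Fin N) R) :
    BddAbove {l | l ≤ N ∧
      LinearIndependent R (fun (j : {j : Fin N // (j : ℕ) < l}) (a : ι) => M a j)} :=
  ⟨N, fun _ hl => hl.1⟩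

theorem le_freeColumns {M : Matrix ι (Fin N) R} {l : ℕ} (hl : l ≤ N)
    (h : LinearIndependent R (fun (j : {j : Fin N // (j : ℕ) < l}) (a : ι) => M a j)) :
    l ≤ freeColumns M :=
  le_csSup (bddAbove_freeColumns M) ⟨hl, h⟩

theorem freeColumns_spec (M : Matrix ι (Fin N) R) :
    freeColumns M ≤ N ∧ LinearIndependent R
      (fun (j : {j : Fin N // (j : ℕ) < freeColumns M}) (a : ι) => M a j) := by
  refine Nat.sSup_mem (s := {l | l ≤ N ∧
      LinearIndependent R (fun (j : {j : Fin N // (j : ℕ) < l}) (a : ι) => M a j)})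
    ⟨0, Nat.zero_le _, ?_⟩ (bddAbove_freeColumns M)
  have : IsEmpty {j : Fin N // (j : ℕ) < 0} := ⟨fun j => Nat.not_lt_zero _ j.2⟩
  exact linearIndependent_empty_type

end FreeColumns

/-! ### Leading monomials give free columns. -/

section FreeCount

variable {R : Type*} [CommRing R] {n s : ℕ} {K : Type*} [Field K] [Algebra R K]
  {w : MonomialOrder (Fin n)}

/-- If all the monomials of degree `|u|` that are at least `u` are leading monomials of
`⟨h₁, …, hᵢ⟩`, the columns of the F5-Macaulay matrix up to that of `u` are free. -/
theorem lt_freeCount [FaithfulSMul R K] (hw : RefinesTotalDegree w)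
    {h : Fin s → MvPolynomial (Fin n) R} (hh : ∀ j, (h j).IsHomogeneous (h j).totalDegree)
    {d : ℕ} {i : Fin s} {j : Fin (monomialsOfDegree n d).card}
    (hlead : ∀ j' ≤ j, column w d j' ∈
      leadingMonomials w (prefixIdeal (fun j => map (algebraMap R K) (h j)) (i + 1))) :
    (j : ℕ) < freeCount K w h d i := by
  classical
  refine Nat.lt_of_succ_le (le_freeColumns (Nat.succ_le_of_lt j.2) ?_)
  rw [linearIndependent_iff]
  intro l hl
  by_contra hne
  -- `q` is the last column, that is, the smallest monomial, in the supposed relation.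
  obtain ⟨q, hq, hmax⟩ := l.support.exists_max_image (fun p => p.1)
    (Finsupp.support_nonempty_iff.mpr hne)
  set hK : Fin s → MvPolynomial (Fin n) K := fun j => map (algebraMap R K) (h j) with hhK
  set dg : Fin s → ℕ := fun j => (h j).totalDegree with hdg
  have hKhom : ∀ j, (hK j).IsHomogeneous (dg j) := fun j => (hh j).map _
  have hKdeg : ∀ j u, dg j < u.degree → (hK j).coeff u = 0 := fun j u hu =>
    (hKhom j).coeff_eq_zero hu.ne'
  have cov : CoversLeadingMonomials w dg hK hK d := by
    have := coversLeadingMonomials_topComponents (w := w) hKdeg hw d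
    rwa [show (fun j => homogeneousComponent (dg j) (hK j)) = hK from
      funext fun j => homogeneousComponent_eq_self (hKhom j)] at this
  -- The column relation as a linear form on polynomials. It kills the F5 rows, hence by the F5
  -- criterion the whole row space.
  let φ : MvPolynomial (Fin n) K →ₗ[K] K :=
    ∑ p ∈ l.support, algebraMap R K (l p) • lcoeff K (column w d p.1)
  have hφ : ∀ p, φ p = ∑ x ∈ l.support, algebraMap R K (l x) * p.coeff (column w d x.1) := by
    intro p
    simp [φ, LinearMap.sum_apply, Algebra.smul_def]
  have hker : macSpan dg hK (i + 1) d ≤ LinearMap.ker φ := by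
    refine (macSpan_le_span_f5Labels hw hKdeg cov (i + 1) i.2 d le_rfl).trans
      (Submodule.span_le.mpr ?_)
    rintro _ ⟨p, ⟨hpi, hpd, hpn⟩, rfl⟩
    rw [SetLike.mem_coe, LinearMap.mem_ker, hφ]
    rcases hpd.eq_or_lt with hpd | hpd
    · have hrow : p ∈ f5Rows K w h d i :=
        ⟨⟨Fin.le_def.mpr (Nat.lt_succ_iff.mp hpi), hpd⟩, hpn⟩
      have h1 := congrFun hl ⟨p, hrow⟩
      rw [Finsupp.linearCombination_apply, Finsupp.sum, Finset.sum_apply, Pi.zero_apply] at h1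
      have h2 := congrArg (algebraMap R K) h1
      rw [map_sum, map_zero] at h2
      rw [← h2]
      refine Finset.sum_congr rfl fun x _ => ?_
      change algebraMap R K (l x) * coeff (column w d x.1) (monomial p.2 1 * hK p.1) =
        algebraMap R K (l x * coeff (column w d x.1) (monomial p.2 1 * h p.1))
      rw [hhK, ← map_monomial_one_mul, coeff_map, (algebraMap R K).map_mul]
    · refine Finset.sum_eq_zero fun x _ => ?_
      have hhom : (monomial p.2 (1 : K) * hK p.1).IsHomogeneous (p.2.degree + dg p.1) :=
        (isHomogeneous_monomial 1 rfl).mul (hKhom _)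
      rw [hhom.coeff_eq_zero, mul_zero]
      rw [degree_column]
      exact hpd.ne'
  -- An element of the row space with leading monomial in column `q` has zero coefficients in the
  -- other columns of the relation, so `φ` cannot kill it.
  obtain ⟨g, hg, hg0, hgq⟩ := cov (i + 1) i.2 (column w d q.1)
    (hlead q.1 (Fin.le_def.mpr (Nat.lt_succ_iff.mp q.2))) (degree_column _).le
  rw [degree_column] at hg
  have h0 : φ g = 0 := hker hg
  rw [hφ, Finset.sum_eq_single_of_mem q hq] at h0
  · refine mul_ne_zero ?_ ?_ h0
    · rw [Ne, FaithfulSMul.algebraMap_eq_zero_iff]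
      exact Finsupp.mem_support_iff.mp hq
    · rw [← hgq]
      exact w.coeff_degree_ne_zero_iff.mpr hg0
  · intro x hx hxq
    rw [w.coeff_eq_zero_of_lt, mul_zero]
    rw [hgq, column_lt]
    exact lt_of_le_of_ne (hmax x hx) fun h => hxq (Subtype.ext h)

end FreeCount

/-! ### Adjugates of minors applied to the rows. -/

section Cramer

variable {A : Type*} [CommRing A] {n s l : ℕ}

/-- The minor of the Macaulay matrix of `F` on the given rows and columns. -/
def minorMatrix (F : Fin s → MvPolynomial (Fin n) A) (row : Fin l → Fin s × (Fin n →₀ ℕ))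
    (col : Fin l → Fin n →₀ ℕ) : Matrix (Fin l) (Fin l) A :=
  Matrix.of fun a b => (monomial (row a).2 1 * F (row a).1).coeff (col b)

/-- The `k`-th row of the product of the adjugate of a minor with the rows of that minor. -/
def cramerPoly (F : Fin s → MvPolynomial (Fin n) A) (row : Fin l → Fin s × (Fin n →₀ ℕ))
    (col : Fin l → Fin n →₀ ℕ) (k : Fin l) : MvPolynomial (Fin n) A :=
  ∑ a, C ((minorMatrix F row col).adjugate k a) * (monomial (row a).2 1 * F (row a).1)

variable {F : Fin s → MvPolynomial (Fin n) A} {row : Fin l → Fin s × (Fin n →₀ ℕ)}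
  {col : Fin l → Fin n →₀ ℕ}

theorem coeff_cramerPoly (k b : Fin l) :
    (cramerPoly F row col k).coeff (col b) = if k = b then (minorMatrix F row col).det else 0 := by
  have h := congrFun (congrFun (Matrix.adjugate_mul (minorMatrix F row col)) k) b
  rw [Matrix.mul_apply, Matrix.smul_apply, Matrix.one_apply, smul_eq_mul, mul_ite, mul_one,
    mul_zero] at h
  rw [← h, cramerPoly, coeff_sum]
  exact Finset.sum_congr rfl fun a _ => coeff_C_mul _ _ _

variable {B : Type*} [CommRing B]

theorem minorMatrix_map (φ : A →+* B) :
    minorMatrix (fun j => map φ (F j)) row col = φ.mapMatrix (minorMatrix F row col) := by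
  ext a b
  simp only [minorMatrix, Matrix.of_apply, RingHom.mapMatrix_apply, Matrix.map_apply]
  rw [← coeff_map, map_monomial_one_mul]

theorem det_minorMatrix_map (φ : A →+* B) :
    (minorMatrix (fun j => map φ (F j)) row col).det = φ (minorMatrix F row col).det := by
  rw [minorMatrix_map, RingHom.map_det]

theorem map_cramerPoly (φ : A →+* B) (k : Fin l) :
    map φ (cramerPoly F row col k) = cramerPoly (fun j => map φ (F j)) row col k := by
  rw [cramerPoly, cramerPoly, map_sum, minorMatrix_map, ← RingHom.map_adjugate]
  refine Finset.sum_congr rfl fun a _ => ?_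
  rw [map_mul, map_C, map_monomial_one_mul]
  rfl

theorem cramerPoly_mem_macSpan {K : Type*} [Field K] {F : Fin s → MvPolynomial (Fin n) K}
    {d : Fin s → ℕ} {t e : ℕ} (h : ∀ a, ((row a).1 : ℕ) < t ∧ (row a).2.degree + d (row a).1 ≤ e)
    (k : Fin l) : cramerPoly F row col k ∈ macSpan d F t e := by
  refine sum_mem fun a _ => ?_
  rw [C_mul']
  exact Submodule.smul_mem _ _ (monomial_mul_mem_macSpan (h a).1 (h a).2)

/-- The coefficients of `cramerPoly` above its leading column vanish. -/
theorem coeff_cramerPoly_eq_zero {w : MonomialOrder (Fin n)} (hw : RefinesTotalDegree w)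
    {d : Fin s → ℕ} (hF : ∀ j u, d j < u.degree → (F j).coeff u = 0) {e : ℕ}
    (hrow : ∀ a, (row a).2.degree + d (row a).1 ≤ e)
    {c : Fin l → Fin (monomialsOfDegree n e).card} (hc : ∀ k, (c k : ℕ) = k) (k : Fin l)
    {u : Fin n →₀ ℕ} (hu : w.toSyn (column w e (c k)) < w.toSyn u) :
    (cramerPoly F row (fun b => column w e (c b)) k).coeff u = 0 := by
  rcases lt_trichotomy u.degree e with h | h | h
  · refine absurd (hw u (column w e (c k)) ?_) (lt_asymm hu)
    rwa [degree_column]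
  · obtain ⟨j, rfl⟩ := exists_column_eq (w := w) h
    rw [column_lt, Fin.lt_def, hc] at hu
    -- The minor uses an initial segment of columns, so a larger monomial of degree `e` is again one
    -- of its columns, where the adjugate identity gives zero.
    obtain ⟨b, rfl⟩ : ∃ b, j = c b := ⟨⟨j, hu.trans k.2⟩, Fin.ext (hc ⟨j, hu.trans k.2⟩).symm⟩
    rw [hc] at hu
    refine (coeff_cramerPoly (col := fun b => column w e (c b)) k _).trans (if_neg ?_)
    rintro rfl
    exact lt_irrefl _ hu
  · rw [cramerPoly, coeff_sum]
    refine Finset.sum_eq_zero fun a _ => ?_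
    rw [coeff_C_mul, coeff_monomial_mul']
    split_ifs with hle
    · obtain ⟨v, rfl⟩ := exists_add_of_le hle
      rw [add_tsub_cancel_left, hF, mul_zero, mul_zero]
      have := hrow a
      rw [map_add] at h
      omega
    · rw [mul_zero]

/-- Minors in the columns of degree `e` only depend on the top components. -/
theorem minorMatrix_homogeneousComponent {d : Fin s → ℕ} {e : ℕ}
    (hrow : ∀ a, (row a).2.degree + d (row a).1 = e) (hcol : ∀ b, (col b).degree = e) :
    minorMatrix (fun j => homogeneousComponent (d j) (F j)) row col = minorMatrix F row col := by
  ext a b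
  simp only [minorMatrix, Matrix.of_apply, coeff_monomial_mul']
  split_ifs with hle
  · rw [coeff_homogeneousComponent, if_pos]
    obtain ⟨v, hv⟩ := exists_add_of_le hle
    have h1 := hrow a
    have h2 := hcol b
    rw [hv, map_add] at h2
    rw [hv, add_tsub_cancel_left]
    omega
  · rfl

end Cramer

/-! ### Regular sequences and divisibility by the reduced bases. -/

section GroebnerCover

variable {n s : ℕ} {K : Type*} [Field K] {w : MonomialOrder (Fin n)}

theorem forall_mem_prefixIdeal_of_H1 {h : Fin s → MvPolynomial (Fin n) K} (h1 : H1 h) (i : Fin s)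
    (a : MvPolynomial (Fin n) K) (ha : a * h i ∈ prefixIdeal h i) : a ∈ prefixIdeal h i := by
  have hI : Ideal.ofList ((List.ofFn h).take i) = prefixIdeal h i := by
    rw [Ideal.ofList, prefixIdeal]
    congr 1
    ext p
    simp only [Set.mem_ofPred_eq, Set.mem_image, List.mem_iff_getElem, List.length_take,
      List.length_ofFn, List.getElem_take, List.getElem_ofFn]
    constructor
    · rintro ⟨j, hj, rfl⟩
      exact ⟨⟨j, by omega⟩, by simp; omega, rfl⟩
    · rintro ⟨j, hj, rfl⟩
      exact ⟨j, by have := j.2; have : (j : ℕ) < i := hj; omega, rfl⟩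
  have hreg := h1.toIsWeaklyRegular.regular_mod_prev i (by simp)
  rw [hI, List.getElem_ofFn, isSMulRegular_quotient_iff_mem_of_smul_mem] at hreg
  have := hreg a
  simp only [smul_eq_mul, Ideal.mul_top] at this
  exact this (by rwa [mul_comm])

theorem prefixIdeal_zero (h : Fin s → MvPolynomial (Fin n) K) : prefixIdeal h 0 = ⊥ := by
  simp [prefixIdeal]

theorem prefixIdeal_self (h : Fin s → MvPolynomial (Fin n) K) :
    prefixIdeal h s = Ideal.span (Set.range h) := by
  rw [prefixIdeal, ← Set.image_univ]
  congr 2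
  exact Set.eq_univ_of_forall fun j => j.2

theorem degree_mono_finsupp {u v : Fin n →₀ ℕ} (h : u ≤ v) : u.degree ≤ v.degree := by
  obtain ⟨t, rfl⟩ := exists_add_of_le h
  rw [map_add]
  exact Nat.le_add_right _ _

theorem exists_mem_reducedBasis {h : Fin s → MvPolynomial (Fin n) K}
    {B : Fin s → Set (MvPolynomial (Fin n) K)}
    (hB : ∀ i : Fin s, IsReducedGroebnerBasis w (prefixIdeal h (i + 1)) (B i))
    {k : ℕ} (hk : k ≤ s) {u : Fin n →₀ ℕ} (hu : u ∈ leadingMonomials w (prefixIdeal h k)) :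
    ∃ i : Fin s, k = i + 1 ∧ ∃ b ∈ B i, w.degree b ≤ u := by
  obtain ⟨p, hp, hp0, rfl⟩ := hu
  rcases k with _ | k
  · rw [prefixIdeal_zero, Ideal.mem_bot] at hp
    exact absurd hp hp0
  · exact ⟨⟨k, hk⟩, rfl, (hB ⟨k, hk⟩).cover p hp hp0⟩

/-- It suffices to attain the leading monomials of the reduced Gröbner bases. -/
theorem coversLeadingMonomials_of_reducedBasis {d : Fin s → ℕ}
    {h F : Fin s → MvPolynomial (Fin n) K} {B : Fin s → Set (MvPolynomial (Fin n) K)}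
    (hB : ∀ i : Fin s, IsReducedGroebnerBasis w (prefixIdeal h (i + 1)) (B i)) {E : ℕ}
    (hatt : ∀ i, ∀ b ∈ B i, (w.degree b).degree ≤ E →
      ∃ q ∈ macSpan d F (i + 1) (w.degree b).degree, q ≠ 0 ∧ w.degree q = w.degree b) :
    CoversLeadingMonomials w d h F E := by
  intro k hk u hu huE
  obtain ⟨i, rfl, b, hb, hbu⟩ := exists_mem_reducedBasis hB hk hu
  obtain ⟨q, hq, hq0, hqb⟩ := hatt i b hb ((degree_mono_finsupp hbu).trans huE)
  obtain ⟨v, rfl⟩ := exists_add_of_le hbu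
  have hv : monomial v (1 : K) ≠ 0 := by simp
  refine ⟨monomial v 1 * q, ?_, mul_ne_zero hv hq0, ?_⟩
  · rw [map_add]
    exact monomial_mul_mem_macSpan_of_mem hq v
  · classical
    rw [w.degree_mul hv hq0, hqb, w.degree_monomial, if_neg one_ne_zero, add_comm]

end GroebnerCover

/-! ### Valuations, congruences and integrality. -/

section Valuation

open IsDiscreteValuationRing

variable {R : Type*} [CommRing R] [IsDomain R] [IsDiscreteValuationRing R]

/-- Turns precision `m` into congruence modulo an ideal, so that perturbation bounds follow from
compatibility with ring homomorphisms. -/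
theorem exists_ideal_forall_mem_iff_le_addVal (R : Type*) [CommRing R] [IsDomain R]
    [IsDiscreteValuationRing R] (m : ℕ) :
    ∃ J : Ideal R, ∀ a, a ∈ J ↔ (m : ℕ∞) ≤ addVal R a := by
  obtain ⟨ϖ, hϖ⟩ := exists_irreducible R
  refine ⟨Ideal.span {ϖ ^ m}, fun a => ?_⟩
  rw [Ideal.mem_span_singleton, ← addVal_le_iff_dvd, hϖ.addVal_pow]

theorem le_addVal_sub {m : ℕ∞} {a b : R} (ha : m ≤ addVal R a) (hb : m ≤ addVal R b) :
    m ≤ addVal R (a - b) :=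
  (addVal R).map_le_sub ha hb

theorem addVal_eq_of_le_addVal_sub {m : ℕ∞} {a b : R} (h : m ≤ addVal R (a - b))
    (hb : addVal R b < m) : addVal R a = addVal R b := by
  have := (addVal R).map_add_eq_of_lt_left (x := b) (y := a - b) (hb.trans_le h)
  rwa [add_sub_cancel] at this

variable {K : Type*} [Field K] [Algebra R K]

theorem inBall_zero (m : ℕ∞) : InBall R m (0 : K) :=
  ⟨0, map_zero _, by simp⟩

theorem eq_zero_of_inBall_top {x : K} (h : InBall R ⊤ x) : x = 0 := by
  obtain ⟨a, rfl, ha⟩ := h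
  rw [top_le_iff, addVal_eq_top_iff] at ha
  rw [ha, map_zero]

end Valuation

theorem exists_map_eq {R K : Type*} [CommRing R] [Field K] [Algebra R K] {n : ℕ}
    {p : MvPolynomial (Fin n) K}
    (hp : ∀ u, ∃ a : R, algebraMap R K a = p.coeff u) :
    ∃ p₀ : MvPolynomial (Fin n) R, map (algebraMap R K) p₀ = p := by
  choose a ha using hp
  refine ⟨∑ u ∈ p.support, monomial u (a u), ?_⟩
  conv_rhs => rw [p.as_sum]
  rw [map_sum]
  exact Finset.sum_congr rfl fun u _ => by rw [map_monomial, ha]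

theorem totalDegree_map_of_injective {A B : Type*} [CommRing A] [CommRing B] {n : ℕ}
    {φ : A →+* B} (hφ : Function.Injective φ) (p : MvPolynomial (Fin n) A) :
    (map φ p).totalDegree = p.totalDegree := by
  rw [totalDegree, totalDegree, support_map_of_injective _ hφ]

theorem coeff_eq_zero_of_totalDegree_lt_degree {A : Type*} [CommRing A] {n : ℕ}
    {p : MvPolynomial (Fin n) A} {u : Fin n →₀ ℕ} (hu : p.totalDegree < u.degree) :
    p.coeff u = 0 := by
  by_contra hne
  refine absurd (le_totalDegree (mem_support_iff.mpr hne)) (not_le.mpr ?_)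
  simpa [Finsupp.degree_eq_sum, Finsupp.sum_fintype] using hu

/-! ### Approximate polynomials with fixed leading monomial, and perturbation of minors. -/

section Truncation

open IsDiscreteValuationRing

variable {R : Type*} [CommRing R] [IsDomain R] [IsDiscreteValuationRing R]
  {K : Type*} [Field K] [Algebra R K] {n s : ℕ} {w : MonomialOrder (Fin n)}

open Classical in
/-- The approximate polynomial with center `q` whose coefficients are known at precision `m` up to
the leading monomial, and exactly beyond. -/
def truncatedApprox (w : MonomialOrder (Fin n)) (m : ℕ) (q : MvPolynomial (Fin n) K) :
    ApproxPoly n K :=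
  ⟨q, fun u => if w.toSyn (w.degree q) < w.toSyn u then ⊤ else m⟩

theorem truncatedApprox_contains {m : ℕ} {q g : MvPolynomial (Fin n) K}
    (hg : ∀ u, w.toSyn (w.degree q) < w.toSyn u → g.coeff u = 0)
    (hball : ∀ u, InBall R m (g.coeff u - q.coeff u)) :
    (truncatedApprox w m q).Contains R g := by
  intro u
  dsimp only [truncatedApprox]
  split_ifs with h
  · rw [hg u h, w.coeff_eq_zero_of_lt h, sub_zero]
    exact inBall_zero _
  · exact hball u

/-- Cancelling the leading coefficient would require it to have valuation at least `m`, and infinite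
precision excludes new terms above it. -/
theorem truncatedApprox_hasFixedLeadingMonomial [FaithfulSMul R K] {m : ℕ}
    {q : MvPolynomial (Fin n) K} {a : R}
    (ha : algebraMap R K a = w.leadingCoeff q) (ham : addVal R a < m) :
    (truncatedApprox w m q).HasFixedLeadingMonomial R w := by
  refine ⟨fun u hu => if_pos hu, fun g hg => ?_⟩
  have hc : g.coeff (w.degree q) ≠ 0 := by
    intro h0
    have h := hg (w.degree q)
    simp only [truncatedApprox, lt_irrefl, if_false] at h
    obtain ⟨b, hb, hbm⟩ := h
    rw [h0, zero_sub] at hb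
    have hab : b = -a := by
      apply FaithfulSMul.algebraMap_injective R K
      rw [hb, map_neg, ha]
      rfl
    rw [hab, (addVal R).map_neg] at hbm
    exact absurd ham (not_lt.mpr hbm)
  refine ⟨fun h => hc (by rw [h, coeff_zero]), monomialOrder_degree_eq w hc fun v hv => ?_⟩
  have h := hg v
  have hv' : w.toSyn (w.degree q) < w.toSyn v := hv
  simp only [truncatedApprox, if_pos hv'] at h
  have := eq_zero_of_inBall_top h
  rwa [w.coeff_eq_zero_of_lt hv', sub_zero] at this

/-- The specializations of an approximation of an integral system are integral, and congruent to
the system. -/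
theorem exists_integral_lift [FaithfulSMul R K] {m : ℕ} {f₀ : Fin s → MvPolynomial (Fin n) R}
    {f' : Fin s → ApproxPoly n K}
    (hf' : IsApproximation R m (fun i => map (algebraMap R K) (f₀ i)) f')
    {F : Fin s → MvPolynomial (Fin n) K} (hF : ∀ i, (f' i).Contains R (F i)) :
    ∃ F₀ : Fin s → MvPolynomial (Fin n) R, (F = fun i => map (algebraMap R K) (F₀ i)) ∧
      (∀ i u, (f₀ i).totalDegree < u.degree → (F₀ i).coeff u = 0) ∧
      ∀ i u, (m : ℕ∞) ≤ addVal R ((F₀ i).coeff u - (f₀ i).coeff u) := by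
  have hinj := FaithfulSMul.algebraMap_injective R K
  have hdeg : ∀ i, (map (algebraMap R K) (f₀ i)).totalDegree = (f₀ i).totalDegree :=
    fun i => totalDegree_map_of_injective hinj _
  have key : ∀ i u, ∃ a : R, algebraMap R K a =
      (F i - map (algebraMap R K) (f₀ i)).coeff u ∧ (f' i).prec u ≤ addVal R a := by
    intro i u
    obtain ⟨a, ha, ham⟩ := hF i u
    obtain ⟨b, hb, hbm⟩ := (hf' i).1 u
    refine ⟨a - b, ?_, le_addVal_sub ham hbm⟩
    rw [map_sub, ha, hb, coeff_sub]
    ring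
  have hex : ∀ i, ∃ p₀ : MvPolynomial (Fin n) R, map (algebraMap R K) p₀ =
      F i - map (algebraMap R K) (f₀ i) := fun i =>
    exists_map_eq fun u => (key i u).imp fun _ h => h.1
  choose p₀ hp₀ using hex
  have hprec : ∀ i u, (f' i).prec u ≤ addVal R ((p₀ i).coeff u) := by
    intro i u
    obtain ⟨a, ha, ham⟩ := key i u
    rw [← hp₀, coeff_map] at ha
    rwa [← hinj ha]
  refine ⟨fun i => f₀ i + p₀ i, ?_, fun i u hu => ?_, fun i u => ?_⟩
  · funext i
    rw [map_add, hp₀, add_sub_cancel]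
  · have htop := ((hf' i).2 u).2 (by rwa [hdeg])
    have h := hprec i u
    rw [htop, top_le_iff, addVal_eq_top_iff] at h
    rw [coeff_add, h, add_zero, coeff_eq_zero_of_totalDegree_lt_degree hu]
  · rw [coeff_add, add_sub_cancel_left]
    refine le_trans ?_ (hprec i u)
    rcases le_or_gt u.degree (f₀ i).totalDegree with h | h
    · exact ((hf' i).2 u).1 (by rwa [hdeg])
    · rw [((hf' i).2 u).2 (by rwa [hdeg])]
      exact le_top

end Truncation

section CramerPerturbation

open IsDiscreteValuationRing

variable {R : Type*} [CommRing R] [IsDomain R] [IsDiscreteValuationRing R] {n s l m : ℕ}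
  {F F' : Fin s → MvPolynomial (Fin n) R} {row : Fin l → Fin s × (Fin n →₀ ℕ)}
  {col : Fin l → Fin n →₀ ℕ}

/-- Minors and Cramer polynomials commute with ring homomorphisms, and `F` and `F'` agree modulo the
elements of valuation at least `m`. As nothing is divided by a minor, no absolute precision is lost.
-/
theorem le_addVal_cramerPoly_sub
    (h : ∀ i u, (m : ℕ∞) ≤ addVal R ((F i).coeff u - (F' i).coeff u)) :
    (∀ k u, (m : ℕ∞) ≤
      addVal R ((cramerPoly F row col k).coeff u - (cramerPoly F' row col k).coeff u)) ∧
    (m : ℕ∞) ≤ addVal R ((minorMatrix F row col).det - (minorMatrix F' row col).det) := by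
  obtain ⟨J, hJ⟩ := exists_ideal_forall_mem_iff_le_addVal R m
  have hmap : (fun i => map (Ideal.Quotient.mk J) (F i)) =
      fun i => map (Ideal.Quotient.mk J) (F' i) := by
    funext i
    ext u
    rw [coeff_map, coeff_map, Ideal.Quotient.eq, hJ]
    exact h i u
  constructor
  · intro k u
    rw [← hJ, ← Ideal.Quotient.eq, ← coeff_map, ← coeff_map, map_cramerPoly, map_cramerPoly, hmap]
  · rw [← hJ, ← Ideal.Quotient.eq, ← det_minorMatrix_map, ← det_minorMatrix_map, hmap]

end CramerPerturbation

section TopComponents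

variable {n s : ℕ}

theorem map_homogeneousComponent {A B : Type*} [CommRing A] [CommRing B] (φ : A →+* B) (t : ℕ)
    (p : MvPolynomial (Fin n) A) :
    map φ (homogeneousComponent t p) = homogeneousComponent t (map φ p) := by
  ext u
  simp only [coeff_map, coeff_homogeneousComponent]
  split_ifs <;> simp

theorem totalDegree_topComponents {A : Type*} [CommRing A] (f : Fin s → MvPolynomial (Fin n) A)
    (j : Fin s) : (topComponents f j).totalDegree = (f j).totalDegree := by
  have hhom : (topComponents f j).IsHomogeneous (f j).totalDegree :=
    homogeneousComponent_isHomogeneous _ _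
  by_cases h0 : f j = 0
  · simp [topComponents, h0]
  refine hhom.totalDegree fun htop => ?_
  obtain ⟨u, hu, hdeg⟩ := Finset.exists_mem_eq_sup (f j).support (support_nonempty.mpr h0)
    fun u => u.sum fun _ e => e
  have h := congrArg (coeff u) htop
  rw [topComponents, coeff_homogeneousComponent, if_pos, coeff_zero] at h
  · exact mem_support_iff.mp hu h
  · rw [totalDegree, hdeg]
    simp [Finsupp.degree_eq_sum, Finsupp.sum_fintype]

end TopComponents

/-! ### From attained leading monomials to Gröbner bases. -/

section Bases

variable {n s : ℕ} {K : Type*} [Field K] {w : MonomialOrder (Fin n)} {d : Fin s → ℕ}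
  {h F : Fin s → MvPolynomial (Fin n) K} {B : Fin s → Set (MvPolynomial (Fin n) K)}

/-- The family `g` in `⟨F⟩` attains the leading monomials of degree at most `D` of the reduced
Gröbner bases `B i`, in the affine Macaulay row spaces of `F`. -/
structure AttainsReducedBases (w : MonomialOrder (Fin n)) (d : Fin s → ℕ) (D : ℕ)
    (B : Fin s → Set (MvPolynomial (Fin n) K)) (F : Fin s → MvPolynomial (Fin n) K) {r : ℕ}
    (g : Fin r → MvPolynomial (Fin n) K) : Prop where
  mem : ∀ k, g k ∈ Ideal.span (Set.range F)
  attains : ∀ i, ∀ b ∈ B i, (w.degree b).degree ≤ D →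
    ∃ k, g k ∈ macSpan d F (i + 1) (w.degree b).degree ∧ g k ≠ 0 ∧ w.degree (g k) = w.degree b

variable {D r : ℕ} {g : Fin r → MvPolynomial (Fin n) K}

theorem AttainsReducedBases.coversLeadingMonomials (hg : AttainsReducedBases w d D B F g)
    (hB : ∀ i : Fin s, IsReducedGroebnerBasis w (prefixIdeal h (i + 1)) (B i)) {E : ℕ}
    (hE : ∀ i, ∀ b ∈ B i, (w.degree b).degree ≤ E → (w.degree b).degree ≤ D) :
    CoversLeadingMonomials w d h F E :=
  coversLeadingMonomials_of_reducedBasis hB fun i b hb hbE =>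
    let ⟨k, hk⟩ := hg.attains i b hb (hE i b hb hbE)
    ⟨g k, hk⟩

/-- The hypothesis `hE` serves two situations: `E = D`, and arbitrary `E` when no element of the `B
i` has a leading monomial of degree above `D`. -/
theorem AttainsReducedBases.exists_degree_le (hg : AttainsReducedBases w d D B F g)
    (hw : RefinesTotalDegree w)
    (hF : ∀ j u, d j < u.degree → (F j).coeff u = 0)
    (hh : ∀ j u, d j < u.degree → (h j).coeff u = 0)
    (hreg : ∀ (i : Fin s) (a : MvPolynomial (Fin n) K),
      a * h i ∈ prefixIdeal h i → a ∈ prefixIdeal h i)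
    (hB : ∀ i : Fin s, IsReducedGroebnerBasis w (prefixIdeal h (i + 1)) (B i)) {E : ℕ}
    (hE : ∀ i, ∀ b ∈ B i, (w.degree b).degree ≤ E → (w.degree b).degree ≤ D)
    {p : MvPolynomial (Fin n) K} (hp : p ∈ macSpan d F s E) (hp0 : p ≠ 0) :
    ∃ k, g k ≠ 0 ∧ w.degree (g k) ≤ w.degree p := by
  have hmem := degree_mem_leadingMonomials_of_mem_macSpan hw hF hh hreg
    (hg.coversLeadingMonomials hB hE) le_rfl hp hp0
  have hdeg : (w.degree p).degree ≤ E := by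
    by_contra hlt
    exact w.coeff_degree_ne_zero_iff.mpr hp0 (coeff_eq_zero_of_mem_macSpan hF hp (not_le.mp hlt))
  obtain ⟨i, -, b, hb, hbp⟩ := exists_mem_reducedBasis hB le_rfl hmem
  obtain ⟨k, -, hk0, hkb⟩ := hg.attains i b hb (hE i b hb ((degree_mono_finsupp hbp).trans hdeg))
  exact ⟨k, hk0, hkb ▸ hbp⟩

theorem AttainsReducedBases.isSystemDGroebnerBasis (hg : AttainsReducedBases w d D B F g)
    (hw : RefinesTotalDegree w)
    (hF : ∀ j u, d j < u.degree → (F j).coeff u = 0)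
    (hh : ∀ j u, d j < u.degree → (h j).coeff u = 0)
    (hreg : ∀ (i : Fin s) (a : MvPolynomial (Fin n) K),
      a * h i ∈ prefixIdeal h i → a ∈ prefixIdeal h i)
    (hB : ∀ i : Fin s, IsReducedGroebnerBasis w (prefixIdeal h (i + 1)) (B i)) :
    IsSystemDGroebnerBasis w D d F g := by
  refine ⟨hg.mem, fun a ha hne => hg.exists_degree_le hw hF hh hreg hB (E := D)
    (fun _ _ _ h => h) (sum_mem fun i _ => mul_mem_macSpan i.2 fun u hu => ?_) hne⟩
  have ha0 : a i ≠ 0 := support_nonempty.mp ⟨u, hu⟩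
  refine (Nat.add_le_add_right ?_ _).trans (ha i ha0)
  by_contra hlt
  exact mem_support_iff.mp hu (coeff_eq_zero_of_totalDegree_lt_degree (not_le.mp hlt))

/-- Every row space, of whatever degree `E`, is under control, so falls of degree do no harm and
`D'` is arbitrary. -/
theorem AttainsReducedBases.isDGroebnerBasis_of_degree_le (hg : AttainsReducedBases w d D B F g)
    (hw : RefinesTotalDegree w)
    (hF : ∀ j u, d j < u.degree → (F j).coeff u = 0)
    (hh : ∀ j u, d j < u.degree → (h j).coeff u = 0)
    (hreg : ∀ (i : Fin s) (a : MvPolynomial (Fin n) K),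
      a * h i ∈ prefixIdeal h i → a ∈ prefixIdeal h i)
    (hB : ∀ i : Fin s, IsReducedGroebnerBasis w (prefixIdeal h (i + 1)) (B i))
    (hD : ∀ i, ∀ b ∈ B i, (w.degree b).degree ≤ D) (D' : ℕ) :
    IsDGroebnerBasis w D' (Ideal.span (Set.range F)) g := by
  refine ⟨hg.mem, fun p hp hp0 _ => ?_⟩
  rw [← prefixIdeal_self] at hp
  obtain ⟨E, hE⟩ := exists_mem_macSpan d hp
  exact hg.exists_degree_le hw hF hh hreg hB (fun i b hb _ => hD i b hb) hE hp0

theorem AttainsReducedBases.isDGroebnerBasis_of_regular (hg : AttainsReducedBases w d D B F g)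
    (hw : RefinesTotalDegree w)
    (hF : ∀ j u, d j < u.degree → (F j).coeff u = 0)
    (hh : ∀ j u, d j < u.degree → (h j).coeff u = 0)
    (hreg : ∀ (i : Fin s) (a : MvPolynomial (Fin n) K),
      a * h i ∈ prefixIdeal h i → a ∈ prefixIdeal h i)
    (hB : ∀ i : Fin s, IsReducedGroebnerBasis w (prefixIdeal h (i + 1)) (B i))
    (hregF : H1 fun i => homogeneousComponent (d i) (F i)) :
    IsDGroebnerBasis w D (Ideal.span (Set.range F)) g := by
  refine ⟨hg.mem, fun p hp hp0 hpD => ?_⟩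
  rw [← prefixIdeal_self] at hp
  obtain ⟨E, hE⟩ := exists_mem_macSpan d hp
  -- Since `p` has degree at most `D`, its components in degrees above `D` vanish, and regularity
  -- lowers the row space one degree at a time.
  have hdesc : ∀ t, p ∈ macSpan d F s (D + t) → p ∈ macSpan d F s D := by
    intro t
    induction t with
    | zero => exact id
    | succ t ih =>
      intro ht
      refine ih (mem_macSpan_of_homogeneousComponent_eq_zero hF
        (forall_mem_prefixIdeal_of_H1 hregF) s le_rfl ht ?_)
      exact homogeneousComponent_eq_zero _ _ (by omega)
  exact hg.exists_degree_le hw hF hh hreg hB (E := D) (fun _ _ _ h => h)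
    (hdesc E (macSpan_mono le_rfl (Nat.le_add_left _ _) hE)) hp0

end Bases

theorem degree_map_cramerPoly {R K : Type*} [CommRing R] [Field K] [Algebra R K]
    [FaithfulSMul R K] {n s : ℕ} {w : MonomialOrder (Fin n)} (hw : RefinesTotalDegree w)
    {F : Fin s → MvPolynomial (Fin n) R}
    {d : Fin s → ℕ} (hF : ∀ j u, d j < u.degree → (F j).coeff u = 0) {l e : ℕ}
    {row : Fin l → Fin s × (Fin n →₀ ℕ)} (hrow : ∀ a, (row a).2.degree + d (row a).1 ≤ e)
    {c : Fin l → Fin (monomialsOfDegree n e).card} (hc : ∀ k, (c k : ℕ) = k)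
    (hdet : (minorMatrix F row fun b => column w e (c b)).det ≠ 0) (k : Fin l) :
    map (algebraMap R K) (cramerPoly F row (fun b => column w e (c b)) k) ≠ 0 ∧
      w.degree (map (algebraMap R K) (cramerPoly F row (fun b => column w e (c b)) k)) =
        column w e (c k) ∧
      w.leadingCoeff (map (algebraMap R K) (cramerPoly F row (fun b => column w e (c b)) k)) =
        algebraMap R K (minorMatrix F row fun b => column w e (c b)).det := by
  have hcoeff : (map (algebraMap R K) (cramerPoly F row (fun b => column w e (c b)) k)).coeff
      (column w e (c k)) = algebraMap R K (minorMatrix F row fun b => column w e (c b)).det := by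
    rw [coeff_map]
    congr 1
    exact (coeff_cramerPoly (col := fun b => column w e (c b)) k k).trans (if_pos rfl)
  have hne : algebraMap R K (minorMatrix F row fun b => column w e (c b)).det ≠ 0 := by
    rwa [Ne, FaithfulSMul.algebraMap_eq_zero_iff]
  have hdeg : w.degree (map (algebraMap R K)
      (cramerPoly F row (fun b => column w e (c b)) k)) = column w e (c k) := by
    refine monomialOrder_degree_eq w (hcoeff ▸ hne) fun v hv => ?_
    rw [coeff_map, coeff_cramerPoly_eq_zero hw hF hrow hc k hv, map_zero]
  refine ⟨fun h => hne ?_, hdeg, ?_⟩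
  · rw [← hcoeff, h, coeff_zero]
  · rw [MonomialOrder.leadingCoeff, hdeg, hcoeff]

/-! ### Construction of the approximate basis. -/

section ApproximateBasis

open IsDiscreteValuationRing

variable {R : Type*} [CommRing R] [IsDomain R] [IsDiscreteValuationRing R]
  {K : Type*} [Field K] [Algebra R K] [FaithfulSMul R K] {n s : ℕ} {w : MonomialOrder (Fin n)}

/-- A family of nonzero minors of the Macaulay matrices gives an approximate basis. -/
theorem exists_attainsReducedBases (hw : RefinesTotalDegree w)
    {f₀ : Fin s → MvPolynomial (Fin n) R} {B : Fin s → Set (MvPolynomial (Fin n) K)}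
    (hlead : ∀ i : Fin s, ∀ g ∈ B i, ∀ b : Fin n →₀ ℕ, b.degree = (w.degree g).degree →
      w.toSyn (w.degree g) ≤ w.toSyn b → b ∈ leadingMonomials w
        (prefixIdeal (fun j => map (algebraMap R K) (topComponents f₀ j)) (i + 1)))
    {D m : ℕ} {δ : ℕ∞} (hδ : δ < m)
    (hminor : ∀ (e : Fin (D + 1)) (i : Fin s),
      ∃ (row : Fin (freeCount K w (topComponents f₀) e i) → Fin s × (Fin n →₀ ℕ))
        (c : Fin (freeCount K w (topComponents f₀) e i) → Fin (monomialsOfDegree n e).card),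
        (∀ k, (c k : ℕ) = k) ∧ (∀ a, row a ∈ macaulayRows (topComponents f₀) e i) ∧
        addVal R (minorMatrix (topComponents f₀) row fun b => column w e (c b)).det ≤ δ)
    {f' : Fin s → ApproxPoly n K}
    (hf' : IsApproximation R m (fun i => map (algebraMap R K) (f₀ i)) f') :
    ∃ (r : ℕ) (G : Fin r → ApproxPoly n K), LossAtMost R w m δ G ∧
      (∀ k, (G k).HasFixedLeadingMonomial R w) ∧
      ∀ F : Fin s → MvPolynomial (Fin n) K, (∀ i, (f' i).Contains R (F i)) →
        (∀ j u, (f₀ j).totalDegree < u.degree → (F j).coeff u = 0) ∧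
        ∃ g : Fin r → MvPolynomial (Fin n) K, (∀ k, (G k).Contains R (g k)) ∧
          AttainsReducedBases w (fun j => (f₀ j).totalDegree) D B F g := by
  choose row c hc hrow hval using hminor
  have hrow' : ∀ e i a, ((row e i a).1 : ℕ) < i + 1 ∧
      (row e i a).2.degree + (f₀ (row e i a).1).totalDegree = e := fun e i a =>
    ⟨Nat.lt_succ_of_le (hrow e i a).1, by
      rw [← totalDegree_topComponents]
      exact (hrow e i a).2⟩
  let ι := Σ e : Fin (D + 1), Σ i : Fin s, Fin (freeCount K w (topComponents f₀) e i)
  let Q : (Fin s → MvPolynomial (Fin n) R) → ι → MvPolynomial (Fin n) R := fun F₀ x =>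
    cramerPoly F₀ (row x.1 x.2.1) (fun b => column w x.1 (c x.1 x.2.1 b)) x.2.2
  -- The chosen minors of `f₀` are those of its top components; a perturbation of valuation at least
  -- `m > δ` preserves their valuations.
  have hdet : ∀ F₀ : Fin s → MvPolynomial (Fin n) R,
      (∀ i u, (m : ℕ∞) ≤ addVal R ((F₀ i).coeff u - (f₀ i).coeff u)) → ∀ e i,
      addVal R (minorMatrix F₀ (row e i) fun b => column w e (c e i b)).det ≤ δ := by
    intro F₀ hF₀ e i
    have h1 := (le_addVal_cramerPoly_sub (row := row e i)
      (col := fun b => column w e (c e i b)) hF₀).2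
    have h2 := hval e i
    have h3 : minorMatrix (topComponents f₀) (row e i) (fun b => column w e (c e i b)) =
        minorMatrix f₀ (row e i) (fun b => column w e (c e i b)) :=
      minorMatrix_homogeneousComponent (d := fun j => (f₀ j).totalDegree)
        (fun a => (hrow' e i a).2) fun b => degree_column _
    rw [h3] at h2
    rw [addVal_eq_of_le_addVal_sub h1 (h2.trans_lt hδ)]
    exact h2
  have hQ : ∀ F₀ : Fin s → MvPolynomial (Fin n) R,
      (∀ i u, (f₀ i).totalDegree < u.degree → (F₀ i).coeff u = 0) →
      (∀ i u, (m : ℕ∞) ≤ addVal R ((F₀ i).coeff u - (f₀ i).coeff u)) → ∀ x : ι,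
      map (algebraMap R K) (Q F₀ x) ≠ 0 ∧
      w.degree (map (algebraMap R K) (Q F₀ x)) = column w x.1 (c x.1 x.2.1 x.2.2) ∧
      w.leadingCoeff (map (algebraMap R K) (Q F₀ x)) = algebraMap R K
        (minorMatrix F₀ (row x.1 x.2.1) fun b => column w x.1 (c x.1 x.2.1 b)).det := by
    intro F₀ h1 h2 x
    refine degree_map_cramerPoly hw h1 (fun a => (hrow' _ _ a).2.le) (hc _ _) (fun h0 => ?_) _
    have := (hdet F₀ h2 x.1 x.2.1).trans_lt (hδ.trans (ENat.natCast_lt_top m))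
    rw [h0, addVal_zero] at this
    exact lt_irrefl _ this
  -- The centers of `f'` form a specialization of `f'`; the centers of `G` are its Cramer
  -- polynomials.
  obtain ⟨P₀, -, hPdeg, hPm⟩ := exists_integral_lift hf' (F := fun i => (f' i).center)
    fun i u => by rw [sub_self]; exact inBall_zero _
  have eqv := Fintype.equivFin ι
  refine ⟨Fintype.card ι, fun k => truncatedApprox w m (map (algebraMap R K) (Q P₀ (eqv.symm k))),
    fun k => ⟨_, (hQ P₀ hPdeg hPm (eqv.symm k)).2.2.symm, fun u => ?_⟩, fun k =>
    truncatedApprox_hasFixedLeadingMonomial (hQ P₀ hPdeg hPm (eqv.symm k)).2.2.symm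
      ((hdet P₀ hPm _ _).trans_lt hδ), fun F hF => ?_⟩
  -- The leading coefficient is the minor, of valuation at most `δ`, and all coefficients have
  -- precision at least `m`.
  · refine add_le_add ?_ (hdet P₀ hPm _ _)
    dsimp only [truncatedApprox]
    split_ifs
    exacts [le_top, le_rfl]
  obtain ⟨F₀, rfl, hFdeg, hFm⟩ := exists_integral_lift hf' hF
  refine ⟨fun j u hu => by rw [coeff_map, hFdeg j u hu, map_zero],
    fun k => map (algebraMap R K) (Q F₀ (eqv.symm k)), fun k => ?_, fun k => ?_, ?_⟩
  · have hFP : ∀ i u, (m : ℕ∞) ≤ addVal R ((F₀ i).coeff u - (P₀ i).coeff u) := by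
      intro i u
      rw [← sub_sub_sub_cancel_right _ _ ((f₀ i).coeff u)]
      exact le_addVal_sub (hFm i u) (hPm i u)
    refine truncatedApprox_contains (fun u hu => ?_) fun u => ?_
    · rw [(hQ P₀ hPdeg hPm _).2.1] at hu
      refine w.coeff_eq_zero_of_lt ?_
      rwa [(hQ F₀ hFdeg hFm _).2.1]
    · refine ⟨_, ?_, (le_addVal_cramerPoly_sub
        (row := row (eqv.symm k).1 (eqv.symm k).2.1)
        (col := fun b => column w (eqv.symm k).1 (c (eqv.symm k).1 (eqv.symm k).2.1 b)) hFP).1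
        (eqv.symm k).2.2 u⟩
      rw [map_sub, ← coeff_map, ← coeff_map]
  · rw [← prefixIdeal_self]
    dsimp only [Q]
    rw [map_cramerPoly]
    exact mem_prefixIdeal_of_mem_macSpan (d := fun j => (f₀ j).totalDegree)
      (cramerPoly_mem_macSpan (fun a => ⟨(row _ _ a).1.2, (hrow' _ _ a).2.le⟩) _)
  · intro i b hb hbD
    -- The weakly-`w` condition makes all the columns up to `j` free, so the column of the leading
    -- monomial of `b` lies in the chosen minor.
    obtain ⟨j, hj⟩ := exists_column_eq (w := w) (u := w.degree b) rfl
    have hlt : (j : ℕ) < freeCount K w (topComponents f₀) (w.degree b).degree i := by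
      refine lt_freeCount hw (fun j => ?_) fun j' hj' => ?_
      · rw [totalDegree_topComponents]
        exact homogeneousComponent_isHomogeneous _ _
      · refine hlead i b hb _ (degree_column _) ?_
        exact (congrArg w.toSyn hj).symm.le.trans (not_lt.mp (mt column_lt.mp (not_lt.mpr hj')))
    let e : Fin (D + 1) := ⟨(w.degree b).degree, Nat.lt_succ_of_le hbD⟩
    let x : ι := ⟨e, i, ⟨j, hlt⟩⟩
    have hx := hQ F₀ hFdeg hFm x
    refine ⟨eqv x, ?_, ?_, ?_⟩
    · rw [Equiv.symm_apply_apply]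
      dsimp only [Q]
      rw [map_cramerPoly]
      exact cramerPoly_mem_macSpan (fun a => ⟨(hrow' e i a).1, (hrow' e i a).2.le⟩) _
    · rw [Equiv.symm_apply_apply]
      exact hx.1
    · rw [Equiv.symm_apply_apply, hx.2.1, ← hj]
      exact congrArg (column w (w.degree b).degree) (Fin.ext (hc e i ⟨j, hlt⟩))

end ApproximateBasis

/-! ### Existence of nonzero and of minimal minors. -/

section Minors

open IsDiscreteValuationRing

/-- Linearly independent first columns have a nonzero minor. -/
theorem exists_submatrix_det_ne_zero {R : Type*} [CommRing R] [IsDomain R] {ι : Type*} {N : ℕ}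
    (M : Matrix ι (Fin N) R) : ∃ (e : Fin (freeColumns M) → ι) (c : Fin (freeColumns M) → Fin N),
      (∀ k, (c k : ℕ) = k) ∧ (M.submatrix e c).det ≠ 0 := by
  classical
  obtain ⟨hN, hind⟩ := freeColumns_spec M
  set l := freeColumns M with hl
  let c : Fin l → Fin N := Fin.castLE hN
  let L := FractionRing R
  have hinj : Function.Injective (algebraMap R L) := IsFractionRing.injective R L
  let v : ι → Fin l → L := fun a b => algebraMap R L (M a (c b))
  -- If the rows did not span, a linear form would kill them all; after clearing denominators its
  -- coefficients are a relation between the independent columns.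
  have hspan : Submodule.span L (Set.range v) = ⊤ := by
    by_contra hne
    obtain ⟨φ, hφ0, hφ⟩ := Submodule.exists_le_ker_of_lt_top _ (lt_top_iff_ne_top.mpr hne)
    obtain ⟨t, ht⟩ := IsLocalization.exist_integer_multiples_of_finite (nonZeroDivisors R)
      fun b : Fin l => φ (Pi.single b 1)
    choose y hy using ht
    have hφv : ∀ x : Fin l → L, φ x = ∑ b, x b * φ (Pi.single b 1) := fun x => by
      conv_lhs => rw [pi_eq_sum_univ' x]
      simp [map_sum]
    have hrel : ∀ a, ∑ b, y b * M a (c b) = 0 := by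
      intro a
      apply hinj
      have h0 : φ (v a) = 0 := hφ (Submodule.subset_span ⟨a, rfl⟩)
      rw [hφv] at h0
      rw [map_sum, map_zero]
      have h1 : (t : R) • ∑ b, v a b * φ (Pi.single b 1) = 0 := by rw [h0, smul_zero]
      rw [Finset.smul_sum] at h1
      rw [← h1]
      refine Finset.sum_congr rfl fun b _ => ?_
      rw [map_mul, hy, ← mul_smul_comm, mul_comm]
    have hind' : LinearIndependent R (fun (b : Fin l) (a : ι) => M a (c b)) :=
      hind.comp (fun b : Fin l => (⟨c b, b.2⟩ : {j : Fin N // (j : ℕ) < l})) fun b b' h =>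
        Fin.castLE_injective hN (congrArg Subtype.val h)
    have hy0 : ∀ b, y b = 0 := Fintype.linearIndependent_iff.mp hind' y (by
      funext a
      simpa [Finset.sum_apply] using hrel a)
    apply hφ0
    ext b
    have h2 := hy b
    rw [hy0, map_zero] at h2
    have ht0 : (t : R) ≠ 0 := nonZeroDivisors.coe_ne_zero t
    simpa [Algebra.smul_def, ht0] using h2.symm
  obtain ⟨κ, a, -, hsp, hli⟩ := exists_linearIndependent' L v
  rw [hspan] at hsp
  let b := Module.Basis.mk hli hsp.ge
  have : Fintype κ := FiniteDimensional.fintypeBasisIndex b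
  have hcard : Fintype.card κ = Fintype.card (Fin l) := by
    rw [← Module.finrank_eq_card_basis b, Module.finrank_fintype_fun_eq_card]
  let eqv : Fin l ≃ κ := (Fintype.equivOfCardEq hcard).symm
  refine ⟨fun k => a (eqv k), c, fun k => rfl, fun hdet => ?_⟩
  have hrows : LinearIndependent L (fun k => v (a (eqv k))) := hli.comp eqv eqv.injective
  have hunit := (Matrix.linearIndependent_rows_iff_isUnit
    (A := (algebraMap R L).mapMatrix (M.submatrix (fun k => a (eqv k)) c))).mp hrows
  rw [Matrix.isUnit_iff_isUnit_det, ← RingHom.map_det, hdet, map_zero] at hunit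
  exact not_isUnit_zero hunit

variable {R : Type*} [CommRing R] [IsDomain R] [IsDiscreteValuationRing R]

/-- A finite infimum in `ℕ∞` is attained. For `δ = ⊤` this could fail, as the infimum over an empty
set of minors is also `⊤`. -/
theorem exists_submatrix_of_minMinorVal_le {ι : Type*} {N l : ℕ} {M : Matrix ι (Fin N) R}
    {δ : ℕ∞} (hδ : δ ≠ ⊤) (h : minMinorVal M l ≤ δ) :
    ∃ (e : Fin l → ι) (c : Fin l → Fin N), (∀ k, (c k : ℕ) = k) ∧
      addVal R (M.submatrix e c).det ≤ δ := by
  have h1 : minMinorVal M l < δ + 1 := (ENat.lt_add_one_iff hδ).mpr h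
  simp only [minMinorVal, iInf_lt_iff] at h1
  obtain ⟨e, c, hc, hlt⟩ := h1
  exact ⟨e, c, hc, (ENat.lt_add_one_iff hδ).mp hlt⟩

end Minors

/-! ### Clearing denominators. -/

section Scaling

variable {n s : ℕ} {K : Type*} [Field K] {a : K}

theorem span_C_mul (ha : a ≠ 0) {ι : Type*} (h : ι → MvPolynomial (Fin n) K) (S : Set ι) :
    Ideal.span ((fun j => C a * h j) '' S) = Ideal.span (h '' S) := by
  have hC : C a⁻¹ * C a = (1 : MvPolynomial (Fin n) K) := by
    rw [← C_mul, inv_mul_cancel₀ ha, C_1]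
  apply le_antisymm
  · rw [Ideal.span_le]
    rintro _ ⟨j, hj, rfl⟩
    exact Ideal.mul_mem_left _ _ (Ideal.subset_span ⟨j, hj, rfl⟩)
  · rw [Ideal.span_le]
    rintro _ ⟨j, hj, rfl⟩
    have h1 : h j = C a⁻¹ * (C a * h j) := by rw [← mul_assoc, hC, one_mul]
    rw [h1]
    exact Ideal.mul_mem_left _ _ (Ideal.subset_span ⟨j, hj, rfl⟩)

theorem prefixIdeal_C_mul (ha : a ≠ 0) (h : Fin s → MvPolynomial (Fin n) K) (k : ℕ) :
    prefixIdeal (fun j => C a * h j) k = prefixIdeal h k :=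
  span_C_mul ha h _

theorem totalDegree_C_mul_of_ne_zero (ha : a ≠ 0) (p : MvPolynomial (Fin n) K) :
    (C a * p).totalDegree = p.totalDegree := by
  have : (C a * p).support = p.support := by
    ext u
    simp [ha]
  rw [totalDegree, totalDegree, this]

theorem topComponents_C_mul (ha : a ≠ 0) (f : Fin s → MvPolynomial (Fin n) K) :
    topComponents (fun j => C a * f j) = fun j => C a * topComponents f j := by
  funext j
  simp only [topComponents]
  rw [totalDegree_C_mul_of_ne_zero ha, homogeneousComponent_C_mul]

theorem map_topComponents {R : Type*} [CommRing R] [Algebra R K] [FaithfulSMul R K]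
    (f₀ : Fin s → MvPolynomial (Fin n) R) :
    (fun j => map (algebraMap R K) (topComponents f₀ j)) =
      topComponents fun j => map (algebraMap R K) (f₀ j) := by
  funext j
  simp only [topComponents]
  rw [map_homogeneousComponent,
    totalDegree_map_of_injective (FaithfulSMul.algebraMap_injective R K)]

theorem exists_integral_multiple (R : Type*) [CommRing R] [IsDomain R] [Algebra R K]
    [IsFractionRing R K] (f : Fin s → MvPolynomial (Fin n) K) :
    ∃ a : R, a ≠ 0 ∧ ∃ f₀ : Fin s → MvPolynomial (Fin n) R,
      ∀ i, map (algebraMap R K) (f₀ i) = C (algebraMap R K a) * f i := by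
  classical
  obtain ⟨t, ht⟩ := IsLocalization.exist_integer_multiples_of_finite (nonZeroDivisors R)
    fun x : Σ i : Fin s, (f i).support => (f x.1).coeff x.2
  have hex : ∀ i, ∃ p₀ : MvPolynomial (Fin n) R,
      map (algebraMap R K) p₀ = C (algebraMap R K t) * f i := by
    intro i
    refine exists_map_eq fun u => ?_
    by_cases hu : u ∈ (f i).support
    · obtain ⟨y, hy⟩ := ht ⟨i, u, hu⟩
      exact ⟨y, by rw [hy, coeff_C_mul, Algebra.smul_def]⟩
    · exact ⟨0, by rw [coeff_C_mul, notMem_support_iff.mp hu, mul_zero, map_zero]⟩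
  choose f₀ hf₀ using hex
  exact ⟨t, nonZeroDivisors.coe_ne_zero t, f₀, hf₀⟩

theorem inBall_mul {R : Type*} [CommRing R] [IsDomain R] [IsDiscreteValuationRing R]
    [Algebra R K] {m : ℕ∞} (a : R) {x : K} (hx : InBall R m x) :
    InBall R m (algebraMap R K a * x) := by
  obtain ⟨b, rfl, hb⟩ := hx
  refine ⟨a * b, map_mul _ _ _, ?_⟩
  rw [IsDiscreteValuationRing.addVal_mul]
  exact hb.trans le_add_self

end Scaling

/-! ### The two statements. -/

section Assembly

open IsDiscreteValuationRing

variable {R : Type*} [CommRing R] [IsDomain R] [IsDiscreteValuationRing R]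
  {K : Type*} [Field K] [Algebra R K] [IsFractionRing R K] {n s : ℕ} {w : MonomialOrder (Fin n)}

theorem coeff_topComponents_eq_zero {A : Type*} [CommRing A] (f : Fin s → MvPolynomial (Fin n) A)
    (j : Fin s) {u : Fin n →₀ ℕ} (hu : (f j).totalDegree < u.degree) :
    (topComponents f j).coeff u = 0 :=
  (homogeneousComponent_isHomogeneous _ (f j)).coeff_eq_zero hu.ne'

theorem mem_leadingMonomials_of_weakly {I : Ideal (MvPolynomial (Fin n) K)}
    {B : Set (MvPolynomial (Fin n) K)} (hB : IsReducedGroebnerBasis w I B)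
    (hweak : ∀ g ∈ B, ∀ b : Fin n →₀ ℕ, b.degree = (w.degree g).degree →
      w.toSyn (w.degree g) < w.toSyn b → b ∈ leadingMonomials w I)
    {g : MvPolynomial (Fin n) K} (hg : g ∈ B) {b : Fin n →₀ ℕ}
    (hb : b.degree = (w.degree g).degree) (hle : w.toSyn (w.degree g) ≤ w.toSyn b) :
    b ∈ leadingMonomials w I := by
  rcases hle.eq_or_lt with h | h
  · refine ⟨g, hB.subset g hg, ?_, w.toSyn.injective h⟩
    rintro rfl
    have := hB.monic 0 hg
    rw [MonomialOrder.leadingCoeff_zero] at this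
    exact zero_ne_one this
  · exact hweak g hg b hb h

/-- For sufficiently large precision, there is an approximate `D`-Gröbner basis of the ideal. -/
theorem exists_approximate_idealBasis (hw : RefinesTotalDegree w)
    (f : Fin s → MvPolynomial (Fin n) K) (h1 : H1 (topComponents f))
    (h2 : H2 w (topComponents f)) (D : ℕ) :
    ∃ M : ℕ, ∀ m : ℕ, M ≤ m → ∀ f' : Fin s → ApproxPoly n K, IsApproximation R m f f' →
      ∃ (r : ℕ) (G : Fin r → ApproxPoly n K), IsApproximateBasis R w
        (fun F g => IsDGroebnerBasis w D (Ideal.span (Set.range F)) g) f' G := by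
  choose B hB hweak using h2
  obtain ⟨a, ha, f₀, hf₀⟩ := exists_integral_multiple R f
  have haK : algebraMap R K a ≠ 0 := by
    rwa [Ne, FaithfulSMul.algebraMap_eq_zero_iff]
  have hmapf : (fun i => map (algebraMap R K) (f₀ i)) = fun i => C (algebraMap R K a) * f i :=
    funext hf₀
  have hdeg : ∀ i, (f₀ i).totalDegree = (f i).totalDegree := fun i => by
    rw [← totalDegree_map_of_injective (FaithfulSMul.algebraMap_injective R K), hf₀,
      totalDegree_C_mul_of_ne_zero haK]
  have hlead : ∀ i : Fin s, ∀ g ∈ B i, ∀ b : Fin n →₀ ℕ, b.degree = (w.degree g).degree →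
      w.toSyn (w.degree g) ≤ w.toSyn b → b ∈ leadingMonomials w
        (prefixIdeal (fun j => map (algebraMap R K) (topComponents f₀ j)) (i + 1)) := by
    intro i g hg b hb hle
    rw [map_topComponents, hmapf, topComponents_C_mul haK, prefixIdeal_C_mul haK]
    exact mem_leadingMonomials_of_weakly (hB i) (hweak i) hg hb hle
  -- The Macaulay matrices are taken up to degree `D'` instead of `D`, so that the reduced bases are
  -- attained entirely.
  obtain ⟨D', hD'⟩ : ∃ D' : ℕ, ∀ i, ∀ b ∈ B i, (w.degree b).degree ≤ D' := by
    have hfin : (⋃ i, (fun b => (w.degree b).degree) '' B i).Finite :=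
      Set.finite_iUnion fun i => (hB i).finite.image _
    obtain ⟨D', h⟩ := hfin.bddAbove
    exact ⟨D', fun i b hb => h (Set.mem_iUnion.mpr ⟨i, b, hb, rfl⟩)⟩
  have hminor : ∀ (e : Fin (D' + 1)) (i : Fin s),
      ∃ (row : Fin (freeCount K w (topComponents f₀) e i) → Fin s × (Fin n →₀ ℕ))
        (c : Fin (freeCount K w (topComponents f₀) e i) → Fin (monomialsOfDegree n e).card),
        (∀ k, (c k : ℕ) = k) ∧ (∀ a, row a ∈ macaulayRows (topComponents f₀) e i) ∧
        (minorMatrix (topComponents f₀) row fun b => column w e (c b)).det ≠ 0 := fun e i => by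
    obtain ⟨row, c, hc, hdet⟩ := exists_submatrix_det_ne_zero
      (macaulayMatrix w (topComponents f₀) e (f5Rows K w (topComponents f₀) e i))
    exact ⟨fun k => (row k).1, c, hc, fun k => (row k).2.1, hdet⟩
  choose row c hc hrow hdet using hminor
  let v : Fin (D' + 1) × Fin s → ℕ := fun x =>
    (addVal R (minorMatrix (topComponents f₀) (row x.1 x.2)
      fun b => column w x.1 (c x.1 x.2 b)).det).toNat
  -- The `+ 1` makes `m` strictly larger than the valuations of all the chosen minors.
  refine ⟨Finset.univ.sup v + 1, fun m hm f' hf' => ?_⟩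
  -- Multiplication by `a ∈ R` does not decrease valuations, so the scaled centers keep the same
  -- precisions; the ideals do not change.
  have hf'' : IsApproximation R m (fun i => map (algebraMap R K) (f₀ i)) fun i =>
      (⟨C (algebraMap R K a) * (f' i).center, (f' i).prec⟩ : ApproxPoly n K) := by
    rw [hmapf]
    refine fun i => ⟨fun u => ?_, fun u => ?_⟩
    · rw [coeff_C_mul, coeff_C_mul, ← mul_sub]
      exact inBall_mul a ((hf' i).1 u)
    · rw [totalDegree_C_mul_of_ne_zero haK]
      exact (hf' i).2 u
  obtain ⟨r, G, -, hfix, hG⟩ := exists_attainsReducedBases (δ := (Finset.univ.sup v : ℕ)) hw hlead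
    (by exact_mod_cast hm) (fun e i => ⟨row e i, c e i, hc e i, hrow e i, by
      have h : v (e, i) ≤ Finset.univ.sup v := Finset.le_sup (Finset.mem_univ _)
      rw [← ENat.natCast_toNat (mt addVal_eq_top_iff.mp (hdet e i))]
      exact_mod_cast h⟩) hf''
  refine ⟨r, G, hfix, fun F hF => ?_⟩
  obtain ⟨hFdeg, g, hg, hatt⟩ := hG (fun i => C (algebraMap R K a) * F i) fun i u => by
    rw [coeff_C_mul, coeff_C_mul, ← mul_sub]
    exact inBall_mul a (hF i u)
  refine ⟨g, hg, ?_⟩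
  have hres := hatt.isDGroebnerBasis_of_degree_le (h := fun j => C (algebraMap R K a) *
    topComponents f j) hw hFdeg (fun j u hu => ?_) (fun i p hp => ?_) (fun i => ?_) hD' D
  · rwa [← Set.image_univ, span_C_mul haK, Set.image_univ] at hres
  · rw [coeff_C_mul, coeff_topComponents_eq_zero f j (by rwa [← hdeg]), mul_zero]
  · rw [prefixIdeal_C_mul haK] at hp ⊢
    have h3 := forall_mem_prefixIdeal_of_H1 h1 i (p * C (algebraMap R K a)) (by rwa [mul_assoc])
    have h4 := Ideal.mul_mem_right (C (algebraMap R K a)⁻¹) _ h3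
    rwa [mul_assoc, ← C_mul, mul_inv_cancel₀ haK, C_1, mul_one] at h4
  · rw [prefixIdeal_C_mul haK]
    exact hB i

/-- The quantitative statement for integral systems, in terms of a common bound `δ` for the
valuations of suitable minors of the Macaulay matrices. -/
theorem exists_approximate_systemBasis (hw : RefinesTotalDegree w)
    (f₀ : Fin s → MvPolynomial (Fin n) R)
    (h1 : H1 (topComponents fun i => map (algebraMap R K) (f₀ i)))
    (h2 : H2 w (topComponents fun i => map (algebraMap R K) (f₀ i))) (D : ℕ)
    {δ : ℕ∞} {m : ℕ} (hδ : δ < m)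
    (hminor : ∀ (e : Fin (D + 1)) (i : Fin s),
      ∃ (row : Fin (freeCount K w (topComponents f₀) e i) → Fin s × (Fin n →₀ ℕ))
        (c : Fin (freeCount K w (topComponents f₀) e i) → Fin (monomialsOfDegree n e).card),
        (∀ k, (c k : ℕ) = k) ∧ (∀ a, row a ∈ macaulayRows (topComponents f₀) e i) ∧
        addVal R (minorMatrix (topComponents f₀) row fun b => column w e (c b)).det ≤ δ)
    {f' : Fin s → ApproxPoly n K}
    (hf' : IsApproximation R m (fun i => map (algebraMap R K) (f₀ i)) f') :
    ∃ (r : ℕ) (G : Fin r → ApproxPoly n K),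
      IsApproximateBasis R w
        (fun F g => IsSystemDGroebnerBasis w D
            (fun i => (map (algebraMap R K) (f₀ i)).totalDegree) F g ∧
          (H1 (fun i => homogeneousComponent (map (algebraMap R K) (f₀ i)).totalDegree (F i)) →
            IsDGroebnerBasis w D (Ideal.span (Set.range F)) g)) f' G ∧
      ((∀ i : Fin s, ∀ B, IsReducedGroebnerBasis w
          (prefixIdeal (topComponents fun i => map (algebraMap R K) (f₀ i)) (i + 1)) B →
          ∀ b ∈ B, b.totalDegree ≤ D) →
        IsApproximateBasis R w
          (fun F g => IsDGroebnerBasis w D (Ideal.span (Set.range F)) g) f' G) ∧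
      LossAtMost R w m δ G := by
  choose B hB hweak using h2
  have hlead : ∀ i : Fin s, ∀ g ∈ B i, ∀ b : Fin n →₀ ℕ, b.degree = (w.degree g).degree →
      w.toSyn (w.degree g) ≤ w.toSyn b → b ∈ leadingMonomials w
        (prefixIdeal (fun j => map (algebraMap R K) (topComponents f₀ j)) (i + 1)) := by
    intro i g hg b hb hle
    rw [map_topComponents]
    exact mem_leadingMonomials_of_weakly (hB i) (hweak i) hg hb hle
  have hdeg : ∀ i, (map (algebraMap R K) (f₀ i)).totalDegree = (f₀ i).totalDegree := fun i =>
    totalDegree_map_of_injective (FaithfulSMul.algebraMap_injective R K) _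
  have hh : ∀ j (u : Fin n →₀ ℕ), (f₀ j).totalDegree < u.degree →
      (topComponents (fun i => map (algebraMap R K) (f₀ i)) j).coeff u = 0 := fun j u hu =>
    coeff_topComponents_eq_zero _ j (by rwa [hdeg])
  have hreg := forall_mem_prefixIdeal_of_H1 h1
  obtain ⟨r, G, hloss, hfix, hG⟩ := exists_attainsReducedBases hw hlead hδ hminor hf'
  refine ⟨r, G, ⟨hfix, fun F hF => ?_⟩, fun hD => ⟨hfix, fun F hF => ?_⟩, hloss⟩
  · obtain ⟨hFdeg, g, hg, hatt⟩ := hG F hF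
    simp only [hdeg]
    exact ⟨g, hg, hatt.isSystemDGroebnerBasis hw hFdeg hh hreg hB,
      hatt.isDGroebnerBasis_of_regular hw hFdeg hh hreg hB⟩
  · obtain ⟨hFdeg, g, hg, hatt⟩ := hG F hF
    refine ⟨g, hg, hatt.isDGroebnerBasis_of_degree_le hw hFdeg hh hreg hB (fun i b hb => ?_) D⟩
    by_contra hlt
    have hb0 : b ≠ 0 := by
      rintro rfl
      simp at hlt
    exact w.coeff_degree_ne_zero_iff.mpr hb0 (coeff_eq_zero_of_totalDegree_lt_degree
      ((hD i _ (hB i) b hb).trans_lt (not_le.mp hlt)))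

end Assembly

end ApproxGroebner

end

open ApproxGroebner in
theorem proposition7p1
    {R : Type*} [CommRing R] [IsDomain R] [IsDiscreteValuationRing R]
    [IsAdicComplete (IsLocalRing.maximalIdeal R) R]
    {K : Type*} [Field K] [Algebra R K] [IsFractionRing R K]
    {n s : ℕ} (w : MonomialOrder (Fin n)) (hw : RefinesTotalDegree w)
    (f : Fin s → MvPolynomial (Fin n) K)
    (h1 : H1 (topComponents f)) (h2 : H2 w (topComponents f)) (D : ℕ) :
    (∃ M : ℕ, ∀ m : ℕ, M ≤ m → ∀ f' : Fin s → ApproxPoly n K, IsApproximation R m f f' →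
      ∃ (r : ℕ) (G : Fin r → ApproxPoly n K),
        IsApproximateBasis R w
          (fun F g => IsDGroebnerBasis w D (Ideal.span (Set.range F)) g) f' G) ∧
    (∀ f₀ : Fin s → MvPolynomial (Fin n) R,
      (∀ i, MvPolynomial.map (algebraMap R K) (f₀ i) = f i) →
      ∀ c : ℕ∞, c = precMF5 K w D (topComponents f₀) ∨ c = precMac K w D (topComponents f₀) →
      ∀ m : ℕ, c < (m : ℕ∞) → ∀ f' : Fin s → ApproxPoly n K, IsApproximation R m f f' →
        ∃ (r : ℕ) (G : Fin r → ApproxPoly n K),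
          IsApproximateBasis R w
            (fun F g =>
              IsSystemDGroebnerBasis w D (fun i => (f i).totalDegree) F g ∧
              (H1 (fun i => MvPolynomial.homogeneousComponent (f i).totalDegree (F i)) →
                IsDGroebnerBasis w D (Ideal.span (Set.range F)) g)) f' G ∧
          ((∀ i : Fin s, ∀ B, IsReducedGroebnerBasis w (prefixIdeal (topComponents f) (i + 1)) B →
              ∀ b ∈ B, b.totalDegree ≤ D) →
            IsApproximateBasis R w
              (fun F g => IsDGroebnerBasis w D (Ideal.span (Set.range F)) g) f' G) ∧
          LossAtMost R w m c G) := by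
  refine ⟨exists_approximate_idealBasis hw f h1 h2 D, fun f₀ hf₀ c hc m hcm f' hf' => ?_⟩
  obtain rfl : (fun i => MvPolynomial.map (algebraMap R K) (f₀ i)) = f := funext hf₀
  -- Finiteness of `c` ensures that minors of valuation at most `c` exist.
  have hctop : c ≠ ⊤ := (hcm.trans_le le_top).ne
  refine exists_approximate_systemBasis hw f₀ h1 h2 D hcm (fun e i => ?_) hf'
  rcases hc with rfl | rfl
  · obtain ⟨row, col, hcol, hdet⟩ := exists_submatrix_of_minMinorVal_le hctop
      (le_iSup₂_of_le (e : ℕ) (Nat.lt_succ_iff.mp e.2) (le_iSup_of_le i le_rfl))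
    exact ⟨fun k => (row k).1, col, hcol, fun k => (row k).2.1, hdet⟩
  · obtain ⟨row, col, hcol, hdet⟩ := exists_submatrix_of_minMinorVal_le hctop
      (le_iSup₂_of_le (e : ℕ) (Nat.lt_succ_iff.mp e.2) (le_iSup_of_le i le_rfl))
    exact ⟨fun k => (row k).1, col, hcol, fun k => (row k).2, hdet⟩
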